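/- For $0<p\le 2$, a symmetric $p$-stable random variable is a real random variable with characteristic function $t\mapsto e^{-|t|^p}$. For $1\le q\le p\le 2$ put $P_q=\frac1{2\pi}\int_0^{2\pi}|\cos\theta|^q\,d\theta$ and $H(a)=\mathbb E\big[|\sin(ag)|^q\big]$, where $g$ is symmetric $p$-stable. For $s>1$ and integers $m,k\ge 0$, let $\varphi_1,\dots,\varphi_k$ be uniform on $[0,2\pi]$ and $g_{ij}$ ($1\le i\le k$, $1\le j\le m$) symmetric $p$-stable, all of them independent, and define the (oblivious) random embedding $f:\ell_p^m\to\ell_q^k$ by $$f(v)_i \;=\; k^{-1/q}\cdot\frac{s}{2P_q^{1/q}}\,\sin\Big(\varphi_i+\frac2s\sum_{j=1}^m g_{ij}v_j\Big).$$ There is an absolute constant $C>0$ such that the following holds for all $1\le q\le p\le 2$, $0<\varepsilon<\frac12$, $s>1$, $m\ge 0$, every $n$-point set $S\subset\ell_p^m$, and every integer $$k\;\ge\; C\cdot\frac{\log n}{\varepsilon^2}\cdot\min\Big\{s^{2q},\ \max\Big\{\frac{s^{2q-p}}{2q-p},\ \varepsilon s^q\Big\}\Big\}$$ (so that one may take $k$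 to be $O$ of this expression; for $2q=p$, i.e. $q=1$, $p=2$, the quotient is read as $\infty$ and the minimum is $s^{2q}$). With probability at least $\frac12$, all pairs $v,w\in S$ satisfy simultaneously, with $t=\|v-w\|_p$: (a) Threshold: $\|f(v)-f(w)\|_q^q< s^q$. (b) If $t\ge 1$, then $(1-\varepsilon)\,s^qH(t/s)\le\|f(v)-f(w)\|_q^q\le(1+\varepsilon)\,s^qH(t/s)$. (c) If $t<1$, then $\|f(v)-f(w)\|_q^q\le s^qH(1/s)+\varepsilon$. Moreover, for $m,k\ge1$ the embedding is computed in time $O(mk)$ per point: there is one program for a real random access machine (unit cost for each real operation $+,-,\times,\sin$, each integer addition or assignment, each memory access and each loop step) which, given $m$, $k$, the two scalars $k^{-1/q}s/(2P_q^{1/q})$ and $2/s$, the random values $\varphi_i,g_{ij}$ and a point $v$, outputs $f(v)$ after at most $C'mk$ steps, with $C'$ an absolute constant. -/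

import Mathlib

open MeasureTheory ProbabilityTheory

namespace SineEmbedding

/-! ## Symmetric stable laws -/

/-- The (standard) symmetric `p`-stable law on the line: the probability measure with
characteristic function `t ↦ exp (-|t| ^ p)`, i.e. with density
`x ↦ (1 / π) * ∫ t in (0, ∞), cos (t * x) * exp (-t ^ p)`. -/
structure IsSymmetricStable (p : ℝ) (μ : Measure ℝ) : Prop where
  isProbabilityMeasure : IsProbabilityMeasure μ
  charFun_eq : ∀ t : ℝ, charFun μ t = ((Real.exp (-|t| ^ p) : ℝ) : ℂ)

/-! The rest of this section proves that the symmetric `p`-stable law exists for `0 < p ≤ 2`. -/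

section Existence

open Filter Topology Set

theorem exists_charFun_eq_of_tendsto {ν : ℕ → ProbabilityMeasure ℝ} {f : ℝ → ℂ}
    (hf : ContinuousAt f 0)
    (h : ∀ t, Tendsto (fun n => charFun (ν n : Measure ℝ) t) atTop (𝓝 (f t))) :
    ∃ μ : ProbabilityMeasure ℝ, ∀ t, charFun (μ : Measure ℝ) t = f t := by
  have ht := isTightMeasureSet_of_tendsto_charFun (μ := fun n => (ν n : Measure ℝ)) hf h
  have hc : IsCompact (closure (Set.range ν)) := by
    apply isCompact_closure_of_isTightMeasureSet
    convert ht using 1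
    ext x; simp
  let U : Ultrafilter ℕ := Ultrafilter.of atTop
  have hU : (U : Filter ℕ) ≤ atTop := Ultrafilter.of_le _
  obtain ⟨μ, -, hμ⟩ := isCompact_iff_ultrafilter_le_nhds.1 hc (U.map ν) (by
    rw [Ultrafilter.coe_map, le_principal_iff]
    exact Filter.mem_map.2 (Filter.univ_mem' fun n => subset_closure ⟨n, rfl⟩))
  refine ⟨μ, fun t => ?_⟩
  have h1 : Tendsto ν U (𝓝 μ) := hμ
  rw [ProbabilityMeasure.tendsto_iff_forall_integral_rclike_tendsto ℂ] at h1
  have h2 := h1 (BoundedContinuousFunction.innerProbChar t)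
  simp_rw [← charFun_eq_integral_innerProbChar] at h2
  exact tendsto_nhds_unique h2 ((h t).mono_left hU)

noncomputable def convPow (μ : Measure ℝ) : ℕ → Measure ℝ
  | 0 => Measure.dirac 0
  | n + 1 => (convPow μ n) ∗ μ

theorem convPow_prob (μ : Measure ℝ) [IsProbabilityMeasure μ] (n : ℕ) :
    IsProbabilityMeasure (convPow μ n) := by
  induction n with
  | zero => unfold convPow; infer_instance
  | succ n ih => unfold convPow; infer_instance

theorem charFun_convPow (μ : Measure ℝ) [IsProbabilityMeasure μ] (n : ℕ) (t : ℝ) :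
    charFun (convPow μ n) t = (charFun μ t) ^ n := by
  induction n with
  | zero => simp [convPow, charFun_dirac]
  | succ n ih =>
    have := convPow_prob μ n
    rw [convPow, charFun_conv, ih, pow_succ]

theorem integrableOn_aux {p : ℝ} (hp0 : 0 < p) (hp2 : p < 2) :
    IntegrableOn (fun u : ℝ => (1 - Real.cos u) * u ^ (-(p + 1))) (Ioi 0) := by
  have hm : Measurable (fun u : ℝ => (1 - Real.cos u) * u ^ (-(p + 1))) := by fun_prop
  rw [← Ioc_union_Ioi_eq_Ioi (zero_le_one (α := ℝ))]
  refine IntegrableOn.union ?_ ?_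
  · have h1 : IntegrableOn (fun u : ℝ => u ^ (1 - p)) (Ioc 0 1) := by
      rw [← intervalIntegrable_iff_integrableOn_Ioc_of_le zero_le_one]
      exact intervalIntegral.intervalIntegrable_rpow' (by linarith)
    refine Integrable.mono' h1 hm.aestronglyMeasurable ?_
    filter_upwards [ae_restrict_mem measurableSet_Ioc] with u hu
    have hu0 : 0 < u := hu.1
    have h2 := Real.one_sub_sq_div_two_le_cos (x := u)
    have h3 := Real.cos_le_one u
    rw [Real.norm_of_nonneg (mul_nonneg (by linarith) (by positivity)),
      show 1 - p = 2 + (-(p + 1)) by ring, Real.rpow_add hu0]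
    gcongr
    rw [Real.rpow_two]; nlinarith [sq_nonneg u]
  · have h1 : IntegrableOn (fun u : ℝ => 2 * u ^ (-(p + 1))) (Ioi 1) :=
      (integrableOn_Ioi_rpow_of_lt (by linarith) zero_lt_one).const_mul 2
    refine Integrable.mono' h1 hm.aestronglyMeasurable ?_
    filter_upwards [ae_restrict_mem measurableSet_Ioi] with u hu
    have hu0 : 0 < u := zero_lt_one.trans hu
    have h2 := Real.neg_one_le_cos u
    have h3 := Real.cos_le_one u
    rw [Real.norm_of_nonneg (mul_nonneg (by linarith) (by positivity))]
    gcongr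
    linarith


noncomputable def tailConst (p : ℝ) : ℝ :=
  ∫ u in Ioi (0 : ℝ), (1 - Real.cos u) * u ^ (-(p + 1))

theorem tailConst_pos {p : ℝ} (hp0 : 0 < p) (hp2 : p < 2) : 0 < tailConst p := by
  unfold tailConst
  have hnn : ∀ u ∈ Ioi (0 : ℝ), 0 ≤ (1 - Real.cos u) * u ^ (-(p + 1)) := fun u hu => by
    have := Real.cos_le_one u
    have hu0 : (0 : ℝ) < u := hu
    exact mul_nonneg (by linarith) (by positivity)
  rw [setIntegral_pos_iff_support_of_nonneg_ae
    ((ae_restrict_mem measurableSet_Ioi).mono hnn) (integrableOn_aux hp0 hp2)]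
  refine lt_of_lt_of_le ?_ (measure_mono (s := Ioo (0 : ℝ) 1) fun u hu => ?_)
  · simp
  · refine ⟨?_, hu.1⟩
    have h1 : Real.cos u < 1 := by
      rw [← Real.cos_zero]
      exact Real.cos_lt_cos_of_nonneg_of_le_pi_div_two le_rfl
        (by have := Real.pi_gt_three; linarith [hu.2]) hu.1
    have := Real.rpow_pos_of_pos hu.1 (-(p + 1))
    rw [Function.mem_support]
    exact (mul_pos (by linarith) this).ne'

noncomputable def symPareto (p : ℝ) : Measure ℝ :=
  (2⁻¹ : ENNReal) • (paretoMeasure 1 p + (paretoMeasure 1 p).map (fun x => (-1) * x))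

theorem symPareto_prob {p : ℝ} (hp : 0 < p) : IsProbabilityMeasure (symPareto p) := by
  have := isProbabilityMeasure_paretoMeasure zero_lt_one hp
  have h2 : IsProbabilityMeasure ((paretoMeasure 1 p).map (fun x => (-1) * x)) :=
    Measure.isProbabilityMeasure_map (by fun_prop)
  constructor
  simp only [symPareto, Measure.smul_apply, Measure.add_apply, measure_univ, smul_eq_mul]
  rw [one_add_one_eq_two, ENNReal.inv_mul_cancel (by simp) (by simp)]

theorem charFun_symPareto {p : ℝ} (hp : 0 < p) (t : ℝ) :
    charFun (symPareto p) t = ((∫ x, Real.cos (t * x) ∂(paretoMeasure 1 p) : ℝ) : ℂ) := by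
  have hP := isProbabilityMeasure_paretoMeasure zero_lt_one hp
  have h2 : IsProbabilityMeasure ((paretoMeasure 1 p).map (fun x => (-1) * x)) :=
    Measure.isProbabilityMeasure_map (by fun_prop)
  have hint : ∀ (μ : Measure ℝ) [IsProbabilityMeasure μ],
      Integrable (fun x : ℝ => Complex.exp (t * x * Complex.I)) μ := fun μ _ => by
    refine Integrable.of_bound (C := 1) (by fun_prop) (Eventually.of_forall fun x => ?_)
    rw [← Complex.ofReal_mul, Complex.norm_exp_ofReal_mul_I]
  have h3 : charFun (symPareto p) t = 2⁻¹ * (charFun (paretoMeasure 1 p) t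
      + charFun ((paretoMeasure 1 p).map (fun x => (-1) * x)) t) := by
    simp only [charFun_apply_real, symPareto]
    rw [integral_smul_measure, integral_add_measure (hint _) (hint _)]
    simp [mul_add]
  rw [h3, charFun_map_mul, neg_one_mul, charFun_neg, Complex.add_conj]
  rw [charFun_apply_real, ← RCLike.re_eq_complex_re, ← integral_re (hint _)]
  push_cast
  rw [← mul_assoc, inv_mul_cancel₀ two_ne_zero, one_mul]
  congr 2
  ext x
  rw [← Complex.ofReal_mul, RCLike.re_eq_complex_re, Complex.exp_ofReal_mul_I_re]

theorem one_sub_integral_cos {p : ℝ} (hp : 0 < p) (t : ℝ) (ht : 0 < t) :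
    1 - ∫ x, Real.cos (t * x) ∂(paretoMeasure 1 p)
      = p * t ^ p * ∫ u in Ioi t, (1 - Real.cos u) * u ^ (-(p + 1)) := by
  have hP := isProbabilityMeasure_paretoMeasure zero_lt_one hp
  have hint : Integrable (fun x : ℝ => Real.cos (t * x)) (paretoMeasure 1 p) :=
    Integrable.of_bound (C := 1) (by fun_prop)
      (Eventually.of_forall fun x => by simpa using Real.abs_cos_le_one _)
  have h1 : 1 - ∫ x, Real.cos (t * x) ∂(paretoMeasure 1 p)
      = ∫ x, (1 - Real.cos (t * x)) ∂(paretoMeasure 1 p) := by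
    rw [integral_sub (integrable_const _) hint]; simp
  rw [h1, paretoMeasure]
  rw [integral_withDensity_eq_integral_toReal_smul (f := paretoPDF 1 p)
    (measurable_paretoPDFReal 1 p).ennreal_ofReal
    (Eventually.of_forall fun x => ENNReal.ofReal_lt_top)]
  have h4 : (fun x => (paretoPDF 1 p x).toReal • (1 - Real.cos (t * x)))
      = (Ici (1 : ℝ)).indicator (fun x => p * (x ^ (-(p + 1)) * (1 - Real.cos (t * x)))) := by
    ext x
    rw [paretoPDF, ENNReal.toReal_ofReal (paretoPDFReal_nonneg zero_le_one hp.le x)]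
    by_cases hx : 1 ≤ x
    · rw [indicator_of_mem (by exact hx), paretoPDFReal, if_pos hx]; simp; ring
    · rw [indicator_of_notMem (by exact hx), paretoPDFReal, if_neg hx]; simp
  rw [h4, integral_indicator measurableSet_Ici, integral_Ici_eq_integral_Ioi, integral_const_mul]
  have h5 := integral_comp_mul_left_Ioi
    (fun u : ℝ => (1 - Real.cos u) * u ^ (-(p + 1))) 1 ht
  rw [mul_one] at h5
  have h6 : ∫ x in Ioi (1 : ℝ), (1 - Real.cos (t * x)) * (t * x) ^ (-(p + 1))
      = t ^ (-(p + 1)) * ∫ x in Ioi (1 : ℝ), x ^ (-(p + 1)) * (1 - Real.cos (t * x)) := by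
    rw [← integral_const_mul]
    refine setIntegral_congr_fun measurableSet_Ioi fun x hx => ?_
    have hx0 : (0 : ℝ) < x := zero_lt_one.trans hx
    rw [Real.mul_rpow ht.le hx0.le]; ring
  rw [h6] at h5
  have h7 : t ^ (-(p + 1)) * (t ^ p * t) = 1 := by
    rw [← Real.rpow_add_one ht.ne', ← Real.rpow_add ht]; simp
  have h8 : (∫ u in Ioi t, (1 - Real.cos u) * u ^ (-(p + 1)))
      = t * (t ^ (-(p + 1)) * ∫ x in Ioi (1 : ℝ), x ^ (-(p + 1)) * (1 - Real.cos (t * x))) := by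
    rw [h5, smul_eq_mul, mul_inv_cancel_left₀ ht.ne']
  rw [h8]
  linear_combination (-p * ∫ x in Ioi (1 : ℝ), x ^ (-(p + 1)) * (1 - Real.cos (t * x))) * h7

theorem exists_isSymmetricStable {p : ℝ} (hp0 : 0 < p) (hp2 : p ≤ 2) :
    ∃ μ : Measure ℝ, IsSymmetricStable p μ := by
  rcases hp2.eq_or_lt with rfl | hp2
  · refine ⟨gaussianReal 0 2, inferInstance, fun t => ?_⟩
    rw [charFun_gaussianReal]
    simp
  have hS := symPareto_prob hp0
  have hC := tailConst_pos hp0 hp2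
  set C := tailConst p with hCdef
  let φ : ℝ → ℝ := fun t => ∫ x, Real.cos (t * x) ∂(paretoMeasure 1 p)
  have hφ_abs : ∀ t, φ t = φ |t| := fun t => by
    rcases abs_choice t with h | h
    · rw [h]
    · rw [h]; simp [φ]
  let c : ℝ := p * C
  have hc : 0 < c := mul_pos hp0 hC
  let a : ℕ → ℝ := fun n => ((n : ℝ) * c) ^ (-p⁻¹)
  have ha : Tendsto a atTop (𝓝 0) :=
    (tendsto_rpow_neg_atTop (inv_pos.2 hp0)).comp
      (tendsto_natCast_atTop_atTop.atTop_mul_const hc)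
  have hprob : ∀ n, IsProbabilityMeasure ((convPow (symPareto p) n).map (a n * ·)) := fun n => by
    have := convPow_prob (symPareto p) n
    exact Measure.isProbabilityMeasure_map (by fun_prop)
  let ν : ℕ → ProbabilityMeasure ℝ := fun n => ⟨(convPow (symPareto p) n).map (a n * ·), hprob n⟩
  have hν : ∀ n t, charFun (ν n : Measure ℝ) t = ((φ (a n * t) ^ n : ℝ) : ℂ) := fun n t => by
    change charFun ((convPow (symPareto p) n).map (a n * ·)) t = _
    rw [charFun_map_mul, charFun_convPow, charFun_symPareto hp0]
    push_cast; rfl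
  have hlim : ∀ t : ℝ, Tendsto (fun n => φ (a n * t) ^ n) atTop (𝓝 (Real.exp (-|t| ^ p))) := by
    intro t
    rcases eq_or_ne t 0 with rfl | ht
    · have hP := isProbabilityMeasure_paretoMeasure zero_lt_one hp0
      simp [φ, Real.zero_rpow hp0.ne']
    have ht' : 0 < |t| := abs_pos.2 ht
    have key := Real.tendsto_one_add_pow_exp_of_tendsto (g := fun n => φ (a n * t) - 1)
      (t := -|t| ^ p) ?_
    · simpa using key
    have hat : Tendsto (fun n => a n * |t|) atTop (𝓝 0) := by simpa using ha.mul_const |t|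
    have hI : Tendsto (fun n => ∫ u in Ioi (a n * |t|), (1 - Real.cos u) * u ^ (-(p + 1)))
        atTop (𝓝 C) := by
      have := (aecover_Ioi_of_Ioi (μ := volume) hat).integral_tendsto_of_countably_generated
        (integrableOn_aux hp0 hp2)
      refine this.congr' ?_
      filter_upwards with n
      rw [Measure.restrict_restrict measurableSet_Ioi, inter_eq_left.2]
      exact Ioi_subset_Ioi (mul_nonneg (by positivity) ht'.le)
    have hI2 := hI.const_mul (-(|t| ^ p / C))
    rw [neg_mul, div_mul_cancel₀ _ hC.ne'] at hI2
    refine hI2.congr' ?_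
    filter_upwards [eventually_gt_atTop 0] with n hn
    have hn' : (0 : ℝ) < n := Nat.cast_pos.2 hn
    have han : 0 < a n := Real.rpow_pos_of_pos (by positivity) _
    have e1 := one_sub_integral_cos hp0 (a n * |t|) (by positivity)
    have e2 : φ (a n * t) = φ (a n * |t|) := by
      rw [hφ_abs, abs_mul, abs_of_pos han]
    have e3 : a n ^ p = ((n : ℝ) * c)⁻¹ := by
      simp only [a]
      rw [← Real.rpow_mul (by positivity), neg_mul, inv_mul_cancel₀ hp0.ne', Real.rpow_neg_one]
    rw [Real.mul_rpow han.le ht'.le, e3] at e1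
    change 1 - φ (a n * |t|) = _ at e1
    rw [e2, show φ (a n * |t|) - 1 = -(1 - φ (a n * |t|)) by ring, e1]
    simp only [c]
    field_simp
  obtain ⟨μ, hμ⟩ := exists_charFun_eq_of_tendsto (ν := ν)
    (f := fun t => ((Real.exp (-|t| ^ p) : ℝ) : ℂ))
    (by
      have : Continuous fun t : ℝ => |t| ^ p := continuous_abs.rpow_const fun _ => Or.inr hp0.le
      exact (Complex.continuous_ofReal.comp (Real.continuous_exp.comp this.neg)).continuousAt)
    (fun t => by
      simp_rw [hν]
      exact (Complex.continuous_ofReal.tendsto _).comp (hlim t))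
  exact ⟨μ, inferInstance, hμ⟩

end Existence

/-- The symmetric `p`-stable law, `0 < p ≤ 2`
(the next two facts say that it exists and is unique). -/
noncomputable def stableLaw (p : ℝ) : Measure ℝ :=
  Classical.epsilon (IsSymmetricStable p)

theorem isSymmetricStable_stableLaw {p : ℝ} (hp0 : 0 < p) (hp2 : p ≤ 2) :
    IsSymmetricStable p (stableLaw p) :=
  Classical.epsilon_spec (exists_isSymmetricStable hp0 hp2)

theorem IsSymmetricStable.eq_stableLaw {p : ℝ} {μ : Measure ℝ} (hp0 : 0 < p) (hp2 : p ≤ 2)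
    (hμ : IsSymmetricStable p μ) : μ = stableLaw p := by
  have h := isSymmetricStable_stableLaw hp0 hp2
  have h1 := hμ.isProbabilityMeasure
  have h2 := h.isProbabilityMeasure
  exact Measure.ext_of_charFun (funext fun t => (hμ.charFun_eq t).trans (h.charFun_eq t).symm)

/-! ## The random embedding -/

/-- The space `ℓ_p^m`, with its `ℓ_p` norm. -/
abbrev Lp (p : ℝ) (m : ℕ) : Type := PiLp (ENNReal.ofReal p) (fun _ : Fin m => ℝ)

/-- `P_q = 𝔼 |cos θ| ^ q` for a uniform angle `θ`. -/
noncomputable def cosMoment (q : ℝ) : ℝ :=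
  (2 * Real.pi)⁻¹ * ∫ θ in (0 : ℝ)..(2 * Real.pi), |Real.cos θ| ^ q

/-- The distance transform `H a = 𝔼 |sin (a * g)| ^ q`, `g` symmetric `p`-stable. -/
noncomputable def transform (p q a : ℝ) : ℝ :=
  ∫ x, |Real.sin (a * x)| ^ q ∂(stableLaw p)

/-- The randomness of the embedding: phases `φ i` and coefficients `g i j`. -/
abbrev Draw (m k : ℕ) : Type := (Fin k → ℝ) × (Fin k → Fin m → ℝ)

/-- All `φ i` and `g i j` are independent, the phases uniform on `[0, 2π]` and the coefficients
symmetric `p`-stable. -/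
noncomputable def drawLaw (p : ℝ) (m k : ℕ) : Measure (Draw m k) :=
  (Measure.pi fun _ : Fin k => (volume : Measure ℝ)[|Set.Icc 0 (2 * Real.pi)]).prod
    (Measure.pi fun _ : Fin k => Measure.pi fun _ : Fin m => stableLaw p)

/-- The single-coordinate embedding
`F v = s / (2 * P_q ^ (1 / q)) * sin (φ + (2 / s) * ∑ j, g j * v j)`. -/
noncomputable def coordinate (q s φ : ℝ) {m : ℕ} (g v : Fin m → ℝ) : ℝ :=
  s / (2 * cosMoment q ^ (1 / q)) * Real.sin (φ + 2 / s * ∑ j, g j * v j)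

/-- The embedding of `ℓ_p^m` into `ℓ_q^k`: the concatenation of `k` independent single-coordinate
embeddings, scaled by `k ^ (-1 / q)`. It is defined on the whole space and depends only on the
random draw (it is oblivious). -/
noncomputable def embedding (p q s : ℝ) {m k : ℕ} (ω : Draw m k) (v : Lp p m) : Lp q k :=
  WithLp.toLp _ fun i => (k : ℝ) ^ (-(1 / q)) * coordinate q s (ω.1 i) (ω.2 i) v.ofLp

/-- `min {s ^ (2q), max {s ^ (2q - p) / (2q - p), ε * s ^ q}}`, where the quotient is read as `∞`
if `2q = p` (that is, if `q = 1` and `p = 2`), so that the value is then `s ^ (2q)`. -/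
noncomputable def dimFactor (p q ε s : ℝ) : ℝ :=
  open Classical in
  if 2 * q = p then s ^ (2 * q)
  else min (s ^ (2 * q)) (max (s ^ (2 * q - p) / (2 * q - p)) (ε * s ^ q))

/-! ## Running time

A real random access machine with structured control flow: the memory has integer registers, real
registers and real arrays; every instruction takes one time step, and a loop takes one step at its
entry and one more step per round. The only control structure besides sequencing is a loop whose
number of rounds is read off an integer register at its entry, so that every program halts. -/

structure Memory where
  int : ℕ → ℕ
  real : ℕ → ℝ
  arr : ℕ → ℕ → ℝ

inductive Program
  /-- `int x := c` -/
  | setInt (x c : ℕ)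
  /-- `int x := int y + int z` -/
  | addInt (x y z : ℕ)
  /-- `real r := arr a [int x]` -/
  | load (r a x : ℕ)
  /-- `arr a [int x] := real r` -/
  | store (a x r : ℕ)
  /-- `real r := real r₁ + real r₂` -/
  | add (r r₁ r₂ : ℕ)
  /-- `real r := real r₁ - real r₂` -/
  | sub (r r₁ r₂ : ℕ)
  /-- `real r := real r₁ * real r₂` -/
  | mul (r r₁ r₂ : ℕ)
  /-- `real r := sin (real r₁)` -/
  | sin (r r₁ : ℕ)
  /-- first `c`, then `d` -/
  | seq (c d : Program)
  /-- `for int x = 0, …, int n - 1 do c` -/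
  | loop (x n : ℕ) (c : Program)

namespace Memory

def writeInt (M : Memory) (x v : ℕ) : Memory :=
  { M with int := Function.update M.int x v }

def writeReal (M : Memory) (r : ℕ) (v : ℝ) : Memory :=
  { M with real := Function.update M.real r v }

def writeArr (M : Memory) (a i : ℕ) (v : ℝ) : Memory :=
  { M with arr := Function.update M.arr a (Function.update (M.arr a) i v) }

end Memory

/-- Run `body`, with the loop counter in the integer register `x`, for the values `0, …, n - 1` of
the counter; return the final memory and the number of steps. -/
def runLoop (body : Memory → Memory × ℕ) (x : ℕ) (M : Memory) : ℕ → Memory × ℕ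
  | 0 => (M, 1)
  | n + 1 =>
    let before := runLoop body x M n
    let after := body (before.1.writeInt x n)
    (after.1, before.2 + 1 + after.2)

/-- The final memory and the number of steps of a run of a program. -/
noncomputable def Program.run : Program → Memory → Memory × ℕ
  | .setInt x c, M => (M.writeInt x c, 1)
  | .addInt x y z, M => (M.writeInt x (M.int y + M.int z), 1)
  | .load r a x, M => (M.writeReal r (M.arr a (M.int x)), 1)
  | .store a x r, M => (M.writeArr a (M.int x) (M.real r), 1)
  | .add r r₁ r₂, M => (M.writeReal r (M.real r₁ + M.real r₂), 1)
  | .sub r r₁ r₂, M => (M.writeReal r (M.real r₁ - M.real r₂), 1)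
  | .mul r r₁ r₂, M => (M.writeReal r (M.real r₁ * M.real r₂), 1)
  | .sin r r₁, M => (M.writeReal r (Real.sin (M.real r₁)), 1)
  | .seq c d, M =>
    let first := c.run M
    let second := d.run first.1
    (second.1, first.2 + second.2)
  | .loop x n c, M => runLoop c.run x M (M.int n)

/-- A vector as the contents of an array (followed by zeros). -/
def toArray {n : ℕ} (v : Fin n → ℝ) (i : ℕ) : ℝ :=
  if h : i < n then v ⟨i, h⟩ else 0

/-- The memory in which the computation of the image of the point `v` starts. It holds the sizes
`m` and `k`, the two scalars of the embedding, the point `v`, the phases, and the coefficients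
`g i j` in row-major order; everything else is zero. None of it but `v` depends on the point. -/
noncomputable def inputMemory (p q s : ℝ) {m k : ℕ} (ω : Draw m k) (v : Lp p m) : Memory where
  int x := if x = 0 then m else if x = 1 then k else 0
  real r :=
    if r = 0 then (k : ℝ) ^ (-(1 / q)) * (s / (2 * cosMoment q ^ (1 / q)))
    else if r = 1 then 2 / s
    else 0
  arr a :=
    if a = 0 then toArray v.ofLp
    else if a = 1 then toArray ω.1
    else if a = 2 then
      toArray fun l : Fin (k * m) => ω.2 (finProdFinEquiv.symm l).1 (finProdFinEquiv.symm l).2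
    else fun _ => 0

end SineEmbedding

/-! By sum-to-product, the difference of one coordinate at `v` and `w` is a constant multiple of the
cosine of a randomly shifted phase times `sin (s⁻¹ * ∑ j, g j * (v j - w j))`. Averaging over the
phase turns the cosine factor into exactly `P_q`, whatever the coefficients are, and by stability
the inner sum is distributed as `‖v - w‖` times one stable variable. So `‖f v - f w‖ ^ q / s ^ q` is
a mean of `k` independent copies of a variable in `[0, 2]` with expectation `H (t / s)`.

Since `q ≥ 1`, the second moment of that variable is at most `4 * 𝔼 sin²`, which the characteristic
function bounds by `8 * min 1 (t / s) ^ p`. On the other side `H a ≥ min 1 a ^ q / 16`. Bernstein's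
inequality with deviation `ε * H (t / s) / 2` for `t ≥ 1`, or `ε * s⁻¹ ^ q / 2` for `t < 1`, then
needs `k` of order `log n * (s ^ (2 * q - p) + ε * s ^ q) / ε ^ 2`, because `2 * q ≥ p`; this is
dominated by the given dimension (`add_le_dimFactor`). A union bound over ordered pairs finishes the
probability estimate.

Two facts on `H` turn concentration into the three bounds. `H ≤ 17 / 24` leaves room below the
threshold `s ^ q`. For (c), `H` is monotone (`transform_mono`): expand `(1 - cos) ^ (q / 2)` in the
binomial series; its coefficients after the constant term are nonpositive as `q / 2 ≤ 1`, and the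
moments of `cos (a * g)` decrease in `a` because powers of cosine are averages of cosines, with
expectations `exp (-|j * a| ^ p)`.

The program is a double loop, one matrix row per coordinate. -/

namespace SineEmbedding

/-! ### The transform `H`: monotonicity and two-sided bounds. -/

section Transform

open Filter Topology Set

theorem isProbabilityMeasure_stableLaw {p : ℝ} (hp0 : 0 < p) (hp2 : p ≤ 2) :
    IsProbabilityMeasure (stableLaw p) :=
  (isSymmetricStable_stableLaw hp0 hp2).isProbabilityMeasure

theorem integral_cos_stableLaw {p : ℝ} (hp0 : 0 < p) (hp2 : p ≤ 2) (t : ℝ) :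
    ∫ x, Real.cos (t * x) ∂(stableLaw p) = Real.exp (-|t| ^ p) := by
  have := isProbabilityMeasure_stableLaw hp0 hp2
  have h := (isSymmetricStable_stableLaw hp0 hp2).charFun_eq t
  have hint : Integrable (fun x : ℝ => Complex.exp (t * x * Complex.I)) (stableLaw p) := by
    refine Integrable.of_bound (C := 1) (by fun_prop) (Eventually.of_forall fun x => ?_)
    rw [← Complex.ofReal_mul, Complex.norm_exp_ofReal_mul_I]
  rw [charFun_apply_real] at h
  have h2 := congrArg RCLike.re h
  rw [← integral_re hint] at h2
  simp only [RCLike.re_eq_complex_re, Complex.ofReal_re] at h2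
  rw [← h2]
  congr 1
  ext x
  rw [← Complex.ofReal_mul, Complex.exp_ofReal_mul_I_re]

theorem integrable_of_continuous_bounded {α : Type*} [TopologicalSpace α] [MeasurableSpace α]
    [OpensMeasurableSpace α] [SecondCountableTopology α] {μ : Measure α} [IsFiniteMeasure μ]
    {f : α → ℝ} (hf : Continuous f) (C : ℝ) (h : ∀ x, |f x| ≤ C) : Integrable f μ :=
  Integrable.of_bound hf.aestronglyMeasurable C (Eventually.of_forall h)

/-- The extra factor `cos (j * a * x)`, with `j` arbitrary, makes the induction close:
product-to-sum absorbs one power of the cosine into shifts of `j` by `±1`, and at power zero the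
expectation is `exp (-|j * a| ^ p)`. Only `j = 0` is used later. -/
theorem integral_cos_pow_mul_cos_antitone {p : ℝ} (hp0 : 0 < p) (hp2 : p ≤ 2) {a b : ℝ}
    (ha : 0 ≤ a) (hab : a ≤ b) (n : ℕ) (j : ℝ) :
    ∫ x, Real.cos (b * x) ^ n * Real.cos (j * b * x) ∂(stableLaw p) ≤
      ∫ x, Real.cos (a * x) ^ n * Real.cos (j * a * x) ∂(stableLaw p) := by
  have := isProbabilityMeasure_stableLaw hp0 hp2
  induction n generalizing j with
  | zero =>
    simp only [pow_zero, one_mul]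
    rw [integral_cos_stableLaw hp0 hp2, integral_cos_stableLaw hp0 hp2]
    gcongr 1
    rw [neg_le_neg_iff, abs_mul, abs_mul, abs_of_nonneg ha, abs_of_nonneg (ha.trans hab)]
    gcongr
  | succ n ih =>
    have key : ∀ c : ℝ, ∫ x, Real.cos (c * x) ^ (n + 1) * Real.cos (j * c * x) ∂(stableLaw p)
        = 2⁻¹ * (∫ x, Real.cos (c * x) ^ n * Real.cos ((j + 1) * c * x) ∂(stableLaw p)
          + ∫ x, Real.cos (c * x) ^ n * Real.cos ((j - 1) * c * x) ∂(stableLaw p)) := by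
      intro c
      have hi : ∀ i : ℝ, Integrable (fun x => Real.cos (c * x) ^ n * Real.cos (i * c * x))
          (stableLaw p) := fun i => by
        refine integrable_of_continuous_bounded (by fun_prop) 1 fun x => ?_
        rw [abs_mul, abs_pow]
        exact mul_le_one₀ (pow_le_one₀ (abs_nonneg _) (Real.abs_cos_le_one _)) (abs_nonneg _)
          (Real.abs_cos_le_one _)
      rw [← integral_add (hi _) (hi _), ← integral_const_mul]
      congr 1
      ext x
      rw [show (j + 1) * c * x = j * c * x + c * x by ring,
        show (j - 1) * c * x = j * c * x - c * x by ring, Real.cos_add, Real.cos_sub]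
      ring
    rw [key, key]
    gcongr 2⁻¹ * (?_ + ?_)
    · exact ih _
    · exact ih _

/-- The ratio of consecutive signed coefficients is `(n - r) / (n + 1)`, nonnegative from `n = 1` on
because `r ≤ 1`; hence all keep the sign of the first, `-r`. -/
theorem neg_one_pow_mul_choose_nonpos {r : ℝ} (hr0 : 0 ≤ r) (hr1 : r ≤ 1) (n : ℕ) :
    (-1) ^ (n + 1) * Ring.choose r (n + 1) ≤ 0 := by
  have hrec : ∀ n : ℕ, ((n : ℝ) + 1) * Ring.choose r (n + 1) = (r - n) * Ring.choose r n := by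
    intro n
    have h1 := Ring.descPochhammer_eq_factorial_smul_choose r n
    have h2 := Ring.descPochhammer_eq_factorial_smul_choose r (n + 1)
    rw [descPochhammer_succ_right, Polynomial.smeval_mul, h1] at h2
    simp only [Polynomial.smeval_sub, Polynomial.smeval_X, Polynomial.smeval_natCast, pow_one,
      pow_zero, nsmul_eq_mul, mul_one, Nat.factorial_succ, Nat.cast_mul, Nat.cast_add,
      Nat.cast_one] at h2
    have hf : ((n.factorial : ℕ) : ℝ) ≠ 0 := by positivity
    apply mul_left_cancel₀ hf
    linear_combination -h2
  induction n with
  | zero => simpa using hr0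
  | succ n ih =>
    have h := hrec (n + 1)
    push_cast at h
    have hn : (0 : ℝ) ≤ n := n.cast_nonneg
    have h3 : ((n : ℝ) + 1 + 1) * ((-1) ^ (n + 1 + 1) * Ring.choose r (n + 1 + 1))
        = (n + 1 - r) * ((-1) ^ (n + 1) * Ring.choose r (n + 1)) := by
      linear_combination (-1) ^ (n + 1 + 1) * h
    have h4 : (n + 1 - r) * ((-1) ^ (n + 1) * Ring.choose r (n + 1)) ≤ 0 :=
      mul_nonpos_of_nonneg_of_nonpos (by linarith) ih
    rw [← h3] at h4
    by_contra! h5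
    have : 0 < ((n : ℝ) + 1 + 1) * ((-1) ^ (n + 1 + 1) * Ring.choose r (n + 1 + 1)) := by
      positivity
    linarith

theorem hasSum_one_sub_rpow (r : ℝ) {y : ℝ} (hy : |y| < 1) :
    HasSum (fun n : ℕ => (-1) ^ n * Ring.choose r n * y ^ n) ((1 - y) ^ r) := by
  have h := (Real.one_add_rpow_hasFPowerSeriesOnBall_zero (a := r)).hasSum (y := -y) (by
    simpa [← ENNReal.ofReal_one, Metric.eball_ofReal] using hy)
  simp only [binomialSeries_apply, List.ofFn_const, List.prod_replicate, smul_eq_mul, zero_add]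
    at h
  have e : (fun n : ℕ => (-1) ^ n * Ring.choose r n * y ^ n)
      = fun n => Ring.choose r n * (-y) ^ n := by
    ext n
    rw [neg_pow y]; ring
  rw [e, sub_eq_add_neg]
  exact h

/-- The damping `ρ < 1` makes the binomial series converge normally, so it can be integrated term by
term; each term is then monotone, as a nonpositive coefficient times an antitone moment. -/
theorem integral_one_sub_mul_cos_rpow_mono {p : ℝ} (hp0 : 0 < p) (hp2 : p ≤ 2) {r : ℝ}
    (hr0 : 0 ≤ r) (hr1 : r ≤ 1) {ρ : ℝ} (hρ0 : 0 ≤ ρ) (hρ1 : ρ < 1) {a b : ℝ}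
    (ha : 0 ≤ a) (hab : a ≤ b) :
    ∫ x, (1 - ρ * Real.cos (a * x)) ^ r ∂(stableLaw p) ≤
      ∫ x, (1 - ρ * Real.cos (b * x)) ^ r ∂(stableLaw p) := by
  have := isProbabilityMeasure_stableLaw hp0 hp2
  have hb : ∀ c x : ℝ, |ρ * Real.cos (c * x)| ≤ ρ := fun c x => by
    rw [abs_mul, abs_of_nonneg hρ0]
    exact mul_le_of_le_one_right hρ0 (Real.abs_cos_le_one _)
  have hsum : ∀ c : ℝ, HasSum
      (fun n : ℕ => ∫ x, (-1) ^ n * Ring.choose r n * (ρ * Real.cos (c * x)) ^ n ∂(stableLaw p))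
      (∫ x, (1 - ρ * Real.cos (c * x)) ^ r ∂(stableLaw p)) := by
    intro c
    have hbd : ∀ (n : ℕ) (x : ℝ), |(-1) ^ n * Ring.choose r n * (ρ * Real.cos (c * x)) ^ n|
        ≤ |(-1) ^ n * Ring.choose r n * ρ ^ n| := fun n x => by
      rw [abs_mul, abs_mul _ (ρ ^ n), abs_pow, abs_pow ρ, abs_of_nonneg hρ0]
      gcongr
      exact hb c x
    have hi : ∀ n : ℕ, Integrable
        (fun x => (-1) ^ n * Ring.choose r n * (ρ * Real.cos (c * x)) ^ n) (stableLaw p) :=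
      fun n => integrable_of_continuous_bounded (by fun_prop) _ (hbd n)
    have h := hasSum_integral_of_summable_integral_norm hi ?_
    · have e : (fun x => (1 - ρ * Real.cos (c * x)) ^ r) = fun x =>
          ∑' n : ℕ, (-1) ^ n * Ring.choose r n * (ρ * Real.cos (c * x)) ^ n := by
        ext x
        exact (hasSum_one_sub_rpow r ((hb c x).trans_lt hρ1)).tsum_eq.symm
      rw [e]
      exact h
    -- The terms are dominated by those of the series at `y = ρ`, which converges absolutely.
    · have hs := (hasSum_one_sub_rpow r (y := ρ) (by rwa [abs_of_nonneg hρ0])).summable.abs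
      refine Summable.of_nonneg_of_le (fun n => integral_nonneg fun x => norm_nonneg _)
        (fun n => ?_) hs
      calc ∫ x, ‖(-1) ^ n * Ring.choose r n * (ρ * Real.cos (c * x)) ^ n‖ ∂(stableLaw p)
          ≤ ∫ _, |(-1) ^ n * Ring.choose r n * ρ ^ n| ∂(stableLaw p) :=
            integral_mono (hi n).norm (integrable_const _) (hbd n)
        _ = _ := by simp
  refine hasSum_le (fun n => ?_) (hsum a) (hsum b)
  rcases n with _ | n
  · simp
  · simp_rw [mul_pow, ← mul_assoc]
    rw [integral_const_mul, integral_const_mul]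
    have h1 := integral_cos_pow_mul_cos_antitone hp0 hp2 ha hab (n + 1) 0
    simp only [zero_mul, Real.cos_zero, mul_one] at h1
    exact mul_le_mul_of_nonpos_left h1 (mul_nonpos_of_nonpos_of_nonneg
      (neg_one_pow_mul_choose_nonpos hr0 hr1 n) (by positivity))

theorem abs_sin_rpow_eq (q x : ℝ) :
    |Real.sin x| ^ q = (2⁻¹ : ℝ) ^ (q / 2) * (1 - Real.cos (2 * x)) ^ (q / 2) := by
  have h1 : |Real.sin x| ^ (2 : ℝ) = 2⁻¹ * (1 - Real.cos (2 * x)) := by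
    rw [Real.rpow_two, sq_abs, Real.sin_sq_eq_half_sub]; ring
  rw [← Real.mul_rpow (by norm_num) (by linarith [Real.cos_le_one (2 * x)]), ← h1,
    ← Real.rpow_mul (abs_nonneg _)]
  congr 1
  ring

/-- Let `ρ` tend to `1` from below in the damped version, by dominated convergence; the damped base
stays in `[0, 2]`. -/
theorem transform_mono {p q : ℝ} (hp0 : 0 < p) (hp2 : p ≤ 2) (hq0 : 0 ≤ q) (hq2 : q ≤ 2) {a b : ℝ}
    (ha : 0 ≤ a) (hab : a ≤ b) : transform p q a ≤ transform p q b := by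
  have := isProbabilityMeasure_stableLaw hp0 hp2
  have hr0 : 0 ≤ q / 2 := by linarith
  have hr1 : q / 2 ≤ 1 := by linarith
  have hlim : ∀ c : ℝ, Tendsto
      (fun ρ : ℝ => ∫ x, (1 - ρ * Real.cos (2 * c * x)) ^ (q / 2) ∂(stableLaw p)) (𝓝[<] 1)
      (𝓝 (∫ x, (1 - 1 * Real.cos (2 * c * x)) ^ (q / 2) ∂(stableLaw p))) := by
    intro c
    refine tendsto_integral_filter_of_dominated_convergence (fun _ => (2 : ℝ) ^ (q / 2)) ?_ ?_
      (integrable_const _) ?_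
    · exact Eventually.of_forall fun ρ =>
        (Continuous.rpow_const (by fun_prop) fun _ => Or.inr hr0).aestronglyMeasurable
    · filter_upwards [Ioo_mem_nhdsLT (zero_lt_one (α := ℝ))] with ρ hρ
      refine Eventually.of_forall fun x => ?_
      have h1 : |ρ * Real.cos (2 * c * x)| ≤ 1 := by
        rw [abs_mul]
        exact mul_le_one₀ (by rw [abs_of_pos hρ.1]; exact hρ.2.le) (abs_nonneg _)
          (Real.abs_cos_le_one _)
      rw [abs_le] at h1
      rw [Real.norm_of_nonneg (Real.rpow_nonneg (by linarith) _)]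
      exact Real.rpow_le_rpow (by linarith) (by linarith) hr0
    · refine Eventually.of_forall fun x => ?_
      have hc : Continuous fun ρ : ℝ => (1 - ρ * Real.cos (2 * c * x)) ^ (q / 2) :=
        Continuous.rpow_const (by fun_prop) fun _ => Or.inr hr0
      exact (hc.tendsto 1).mono_left nhdsWithin_le_nhds
  have h := le_of_tendsto_of_tendsto (hlim a) (hlim b) (by
    filter_upwards [Ioo_mem_nhdsLT (zero_lt_one (α := ℝ))] with ρ hρ
    exact integral_one_sub_mul_cos_rpow_mono hp0 hp2 hr0 hr1 hρ.1.le hρ.2 (by linarith)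
      (by linarith))
  unfold transform
  simp_rw [abs_sin_rpow_eq, ← mul_assoc, integral_const_mul]
  simp only [one_mul] at h
  gcongr

theorem integral_sin_sq_stableLaw {p : ℝ} (hp0 : 0 < p) (hp2 : p ≤ 2) (a : ℝ) :
    ∫ x, Real.sin (a * x) ^ 2 ∂(stableLaw p) = (1 - Real.exp (-|2 * a| ^ p)) / 2 := by
  have := isProbabilityMeasure_stableLaw hp0 hp2
  simp_rw [Real.sin_sq_eq_half_sub]
  have hi : Integrable (fun x => Real.cos (2 * (a * x))) (stableLaw p) :=
    integrable_of_continuous_bounded (by fun_prop) 1 fun x => Real.abs_cos_le_one _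
  rw [integral_sub (integrable_const _) (hi.div_const _), integral_div]
  simp_rw [← mul_assoc]
  rw [integral_div, integral_cos_stableLaw hp0 hp2]
  simp
  ring

theorem integrable_abs_sin_rpow {α : Type*} [TopologicalSpace α] [MeasurableSpace α]
    [OpensMeasurableSpace α] [SecondCountableTopology α] {μ : Measure α} [IsFiniteMeasure μ]
    {q : ℝ} (hq : 0 ≤ q) {f : α → ℝ} (hf : Continuous f) :
    Integrable (fun x => |Real.sin (f x)| ^ q) μ := by
  refine integrable_of_continuous_bounded
    (Continuous.rpow_const (by fun_prop) fun _ => Or.inr hq) 1 fun x => ?_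
  rw [abs_of_nonneg (by positivity)]
  exact Real.rpow_le_one (abs_nonneg _) (Real.abs_sin_le_one _) hq

theorem transform_nonneg (p q a : ℝ) : 0 ≤ transform p q a :=
  integral_nonneg fun _ => by positivity

theorem sq_le_abs_rpow {x q : ℝ} (hq2 : q ≤ 2) (hx : |x| ≤ 1) : x ^ 2 ≤ |x| ^ q := by
  rw [← sq_abs, ← Real.rpow_two]
  exact Real.rpow_le_rpow_of_exponent_ge_of_imp (abs_nonneg _) hx hq2
    fun _ h => absurd h (by norm_num)

theorem transform_le {p q : ℝ} (hp0 : 0 < p) (hp2 : p ≤ 2) (hq : 1 ≤ q) (a : ℝ) :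
    transform p q a ≤ 17 / 24 := by
  have := isProbabilityMeasure_stableLaw hp0 hp2
  have hi : Integrable (fun x => Real.sin (a * x) ^ 2) (stableLaw p) :=
    integrable_of_continuous_bounded (by fun_prop) 1 fun x => by
      rw [abs_pow]; exact pow_le_one₀ (abs_nonneg _) (Real.abs_sin_le_one _)
  calc transform p q a
      ≤ ∫ x, (2 / 3 * Real.sin (a * x) ^ 2 + 3 / 8) ∂(stableLaw p) := by
        refine integral_mono (integrable_abs_sin_rpow (by linarith) (by fun_prop))
          ((hi.const_mul _).add (integrable_const _)) fun x => ?_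
        have h1 : |Real.sin (a * x)| ^ q ≤ |Real.sin (a * x)| ^ (1 : ℝ) :=
          Real.rpow_le_rpow_of_exponent_ge_of_imp (abs_nonneg _) (Real.abs_sin_le_one _) hq
            fun _ h => absurd h (by linarith)
        rw [Real.rpow_one] at h1
        dsimp only
        rw [← sq_abs (Real.sin (a * x))]
        -- With `y = |sin (a * x)|`, the gap `2 / 3 * y ^ 2 + 3 / 8 - y` is `2 / 3 * (y - 3 / 4) ^
        -- 2`. As `𝔼 sin² ≤ 1 / 2`, this yields `1 / 3 + 3 / 8 = 17 / 24`.
        nlinarith [sq_nonneg (|Real.sin (a * x)| - 3 / 4)]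
    _ = 2 / 3 * ((1 - Real.exp (-|2 * a| ^ p)) / 2) + 3 / 8 := by
        rw [integral_add (hi.const_mul _) (integrable_const _), integral_const_mul,
          integral_sin_sq_stableLaw hp0 hp2]
        simp
    _ ≤ 17 / 24 := by linarith [Real.exp_pos (-|2 * a| ^ p)]

theorem abs_sin_nat_mul_le (n : ℕ) (x : ℝ) : |Real.sin (n * x)| ≤ n * |Real.sin x| := by
  induction n with
  | zero => simp
  | succ n ih =>
    push_cast
    rw [add_mul, one_mul, Real.sin_add]
    calc |Real.sin (n * x) * Real.cos x + Real.cos (n * x) * Real.sin x|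
        ≤ |Real.sin (n * x)| * |Real.cos x| + |Real.cos (n * x)| * |Real.sin x| := by
          rw [← abs_mul, ← abs_mul]; exact abs_add_le _ _
      _ ≤ |Real.sin (n * x)| * 1 + 1 * |Real.sin x| := by
          gcongr
          · exact Real.abs_cos_le_one _
          · exact Real.abs_cos_le_one _
      _ ≤ (n + 1) * |Real.sin x| := by linarith

theorem transform_nat_mul_le {p q : ℝ} (hp0 : 0 < p) (hp2 : p ≤ 2) (hq : 0 ≤ q) (n : ℕ) (a : ℝ) :
    transform p q (n * a) ≤ (n : ℝ) ^ q * transform p q a := by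
  have := isProbabilityMeasure_stableLaw hp0 hp2
  unfold transform
  rw [← integral_const_mul]
  refine integral_mono (integrable_abs_sin_rpow hq (by fun_prop))
    ((integrable_abs_sin_rpow hq (by fun_prop)).const_mul _) fun x => ?_
  dsimp only
  rw [← Real.mul_rpow (by positivity) (abs_nonneg _), mul_assoc]
  exact Real.rpow_le_rpow (abs_nonneg _) (abs_sin_nat_mul_le _ _) hq

theorem le_transform_of_one_le {p q : ℝ} (hp0 : 0 < p) (hp2 : p ≤ 2) (hq0 : 0 ≤ q) (hq2 : q ≤ 2)
    {a : ℝ} (ha : 1 ≤ a) : 1 / 4 ≤ transform p q a := by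
  have := isProbabilityMeasure_stableLaw hp0 hp2
  have h1 : ∫ x, Real.sin (a * x) ^ 2 ∂(stableLaw p) ≤ transform p q a := by
    refine integral_mono (integrable_of_continuous_bounded (by fun_prop) 1 fun x => ?_)
      (integrable_abs_sin_rpow hq0 (by fun_prop)) fun x => ?_
    · rw [abs_pow]; exact pow_le_one₀ (abs_nonneg _) (Real.abs_sin_le_one _)
    · exact sq_le_abs_rpow hq2 (Real.abs_sin_le_one _)
  rw [integral_sin_sq_stableLaw hp0 hp2] at h1
  have h2 : 1 ≤ |2 * a| ^ p := Real.one_le_rpow (by rw [abs_of_nonneg] <;> linarith) hp0.le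
  have h3 : Real.exp (-|2 * a| ^ p) ≤ Real.exp (-1) := Real.exp_le_exp.2 (by linarith)
  have h4 : Real.exp (-1) ≤ 1 / 2 := by
    rw [Real.exp_neg, inv_le_comm₀ (Real.exp_pos _) (by norm_num)]
    linarith [Real.add_one_le_exp (1 : ℝ)]
  linarith

/-- For `a ≤ 1`, scale up by an integer `N` with `1 ≤ N * a ≤ 2`: there `H ≥ 1 / 4`, while `|sin (N
* x)| ≤ N * |sin x|` costs at most `N ^ q ≤ 4 / a ^ q`. -/
theorem min_rpow_le_transform {p q : ℝ} (hp0 : 0 < p) (hp2 : p ≤ 2) (hq0 : 0 ≤ q) (hq2 : q ≤ 2)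
    {a : ℝ} (ha : 0 < a) : (min 1 a) ^ q / 16 ≤ transform p q a := by
  rcases le_total 1 a with h | h
  · rw [min_eq_left h, Real.one_rpow]
    linarith [le_transform_of_one_le hp0 hp2 hq0 hq2 h]
  rw [min_eq_right h]
  set N := ⌈a⁻¹⌉₊
  have hN1 : a⁻¹ ≤ N := Nat.le_ceil _
  have hN2 : (N : ℝ) ≤ 2 * a⁻¹ := by
    have := Nat.ceil_lt_add_one (inv_nonneg.2 ha.le)
    have := (one_le_inv₀ ha).2 h
    linarith
  have h1 : 1 ≤ N * a := by
    rw [inv_le_iff_one_le_mul₀ ha] at hN1; exact hN1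
  have h2 : N * a ≤ 2 := by
    calc N * a ≤ 2 * a⁻¹ * a := by gcongr
      _ = 2 := by field_simp
  have h3 := le_transform_of_one_le hp0 hp2 hq0 hq2 h1
  have h4 := transform_nat_mul_le hp0 hp2 hq0 N a
  have h5 : (N : ℝ) ^ q * a ^ q ≤ 4 := by
    rw [← Real.mul_rpow (by positivity) ha.le]
    calc (N * a) ^ q ≤ (N * a) ^ (2 : ℝ) := Real.rpow_le_rpow_of_exponent_le h1 hq2
      _ ≤ 2 ^ (2 : ℝ) := Real.rpow_le_rpow (by positivity) h2 (by norm_num)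
      _ = 4 := by norm_num
  have h6 : 0 ≤ a ^ q := by positivity
  have h7 := transform_nonneg p q a
  nlinarith

theorem integral_sin_sq_le {p : ℝ} (hp0 : 0 < p) (hp2 : p ≤ 2) {a : ℝ} (ha : 0 ≤ a) :
    ∫ x, Real.sin (a * x) ^ 2 ∂(stableLaw p) ≤ 2 * (min 1 a) ^ p := by
  rw [integral_sin_sq_stableLaw hp0 hp2]
  rcases le_total 1 a with h | h
  · rw [min_eq_left h, Real.one_rpow]
    linarith [Real.exp_pos (-|2 * a| ^ p)]
  · rw [min_eq_right h]
    have h1 := Real.add_one_le_exp (-|2 * a| ^ p)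
    have h2 : |2 * a| ^ p ≤ 4 * a ^ p := by
      rw [abs_of_nonneg (by linarith), Real.mul_rpow (by norm_num) ha]
      gcongr
      calc (2 : ℝ) ^ p ≤ 2 ^ (2 : ℝ) := Real.rpow_le_rpow_of_exponent_le (by norm_num) hp2
        _ = 4 := by norm_num
    linarith

end Transform

/-! ### Bernstein's inequality for independent copies. -/

section Concentration

/-- Chernoff's method: `exp x ≤ 1 + x + x ^ 2` for `|x| ≤ 1` bounds the moment generating function
of a centred variable by `exp (l ^ 2 * V)`. -/
theorem measureReal_le_sum_le_exp {γ : Type*} [MeasurableSpace γ] {μ : Measure γ}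
    [IsProbabilityMeasure μ] {Y : γ → ℝ} (hY : Measurable Y) (hb : ∀ x, |Y x| ≤ 2)
    (hm : ∫ x, Y x ∂μ = 0) {V δ : ℝ} (hV0 : 0 ≤ V) (hV : ∫ x, Y x ^ 2 ∂μ ≤ V) (hδ : 0 < δ)
    (k : ℕ) :
    (Measure.pi fun _ : Fin k => μ).real {ω | k * δ ≤ ∑ i, Y (ω i)} ≤
      Real.exp (-(k * (δ ^ 2 / (4 * (V + δ))))) := by
  -- This choice gives `l ≤ 1 / 2`, hence `|l * Y| ≤ 1`, and `l * (V + δ) = δ / 2`, so that the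
  -- exponent `l ^ 2 * V - l * δ` is at most `-l * δ / 2`.
  set l := δ / (2 * (V + δ)) with hl
  have hl0 : 0 ≤ l := by positivity
  have hl1 : l ≤ 1 / 2 := by
    rw [hl, div_le_div_iff₀ (by positivity) (by norm_num)]
    linarith
  have hlY : ∀ x, |l * Y x| ≤ 1 := fun x => by
    rw [abs_mul, abs_of_nonneg hl0]
    nlinarith [hb x, abs_nonneg (Y x)]
  have hiY : Integrable Y μ :=
    Integrable.of_bound hY.aestronglyMeasurable 2 (Filter.Eventually.of_forall hb)
  have hiY2 : Integrable (fun x => Y x ^ 2) μ :=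
    Integrable.of_bound (hY.pow_const 2).aestronglyMeasurable 4
      (Filter.Eventually.of_forall fun x => by
        rw [Real.norm_eq_abs, abs_pow]
        nlinarith [hb x, abs_nonneg (Y x)])
  have hie : Integrable (fun x => Real.exp (l * Y x)) μ :=
    Integrable.of_bound (by fun_prop) (Real.exp 1) (Filter.Eventually.of_forall fun x => by
      rw [Real.norm_eq_abs, Real.abs_exp]
      exact Real.exp_le_exp.2 ((le_abs_self _).trans (hlY x)))
  have hmgf : ∫ x, Real.exp (l * Y x) ∂μ ≤ Real.exp (l ^ 2 * V) := by
    calc ∫ x, Real.exp (l * Y x) ∂μ ≤ ∫ x, (1 + l * Y x + l ^ 2 * Y x ^ 2) ∂μ := by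
          refine integral_mono hie
            (((integrable_const _).add (hiY.const_mul l)).add (hiY2.const_mul _)) fun x => ?_
          have h := (abs_le.1 (Real.abs_exp_sub_one_sub_id_le (hlY x))).2
          dsimp only
          linarith [mul_pow l (Y x) 2]
      _ = 1 + l ^ 2 * ∫ x, Y x ^ 2 ∂μ := by
          have hi : Integrable (fun x => 1 + l * Y x) μ :=
            (integrable_const _).add (hiY.const_mul l)
          rw [integral_add hi (hiY2.const_mul _), integral_add (integrable_const _) (hiY.const_mul l), integral_const_mul,
            integral_const_mul, hm]
          simp
      _ ≤ 1 + l ^ 2 * V := by gcongr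
      _ ≤ Real.exp (l ^ 2 * V) := by linarith [Real.add_one_le_exp (l ^ 2 * V)]
  have hexp : ∀ ω : Fin k → γ,
      Real.exp (l * ∑ i, Y (ω i)) = ∏ i, Real.exp (l * Y (ω i)) := fun ω => by
    rw [Finset.mul_sum, Real.exp_sum]
  have h := measure_ge_le_exp_mul_mgf (μ := Measure.pi fun _ : Fin k => μ)
    (X := fun ω => ∑ i, Y (ω i)) (k * δ) hl0 (by
      simp_rw [hexp]
      exact Integrable.fintype_prod fun _ => hie)
  refine h.trans ?_
  unfold mgf
  simp_rw [hexp]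
  rw [integral_fintype_prod_eq_pow (fun x => Real.exp (l * Y x)), Fintype.card_fin]
  calc Real.exp (-l * (k * δ)) * (∫ x, Real.exp (l * Y x) ∂μ) ^ k
      ≤ Real.exp (-l * (k * δ)) * Real.exp (l ^ 2 * V) ^ k := by
        gcongr
    _ = Real.exp (k * (l ^ 2 * V - l * δ)) := by
        rw [← Real.exp_nat_mul, ← Real.exp_add]
        congr 1
        ring
    _ ≤ Real.exp (-(k * (δ ^ 2 / (4 * (V + δ))))) := by
        rw [Real.exp_le_exp, ← mul_neg]
        gcongr
        have h1 : l * (V + δ) = δ / 2 := by rw [hl]; field_simp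
        have h2 : δ ^ 2 / (4 * (V + δ)) = l * δ / 2 := by rw [hl]; field_simp; norm_num
        rw [h2]
        nlinarith [mul_nonneg (mul_nonneg hl0 hl0) hδ.le]

/-- Bernstein's inequality for the mean of independent copies of a variable in `[0, 2]`. -/
theorem measureReal_le_abs_mean_sub_le {γ : Type*} [MeasurableSpace γ] {μ : Measure γ}
    [IsProbabilityMeasure μ] {X : γ → ℝ} (hX : Measurable X) (h0 : ∀ x, 0 ≤ X x)
    (h2 : ∀ x, X x ≤ 2) {V δ : ℝ} (hV : ∫ x, X x ^ 2 ∂μ ≤ V) (hδ : 0 < δ)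
    {k : ℕ} (hk : 0 < k) :
    (Measure.pi fun _ : Fin k => μ).real
        {ω | δ ≤ |(k : ℝ)⁻¹ * ∑ i, X (ω i) - ∫ x, X x ∂μ|} ≤
      2 * Real.exp (-(k * (δ ^ 2 / (4 * (V + δ))))) := by
  set m := ∫ x, X x ∂μ with hm
  have hk' : (0 : ℝ) < k := Nat.cast_pos.2 hk
  have hiX : Integrable X μ :=
    Integrable.of_bound hX.aestronglyMeasurable 2 (Filter.Eventually.of_forall fun x => by
      rw [Real.norm_of_nonneg (h0 x)]; exact h2 x)
  have hiX2 : Integrable (fun x => X x ^ 2) μ :=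
    Integrable.of_bound (hX.pow_const 2).aestronglyMeasurable 4
      (Filter.Eventually.of_forall fun x => by
        rw [Real.norm_of_nonneg (sq_nonneg _)]
        nlinarith [h0 x, h2 x])
  have hm0 : 0 ≤ m := integral_nonneg h0
  have hm2 : m ≤ 2 := by
    calc m ≤ ∫ _, (2 : ℝ) ∂μ := integral_mono hiX (integrable_const _) h2
      _ = 2 := by simp
  have hV0 : 0 ≤ V := (integral_nonneg fun x => sq_nonneg _).trans hV
  have hvar : ∫ x, (X x - m) ^ 2 ∂μ ≤ V := by
    have e : ∀ x, (X x - m) ^ 2 = X x ^ 2 - 2 * m * X x + m ^ 2 := fun x => by ring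
    simp_rw [e]
    have hi : Integrable (fun x => X x ^ 2 - 2 * m * X x) μ := hiX2.sub (hiX.const_mul _)
    rw [integral_add hi (integrable_const _),
      integral_sub hiX2 (hiX.const_mul _), integral_const_mul, ← hm]
    simp only [integral_const, probReal_univ, one_smul]
    nlinarith
  have hcen : ∫ x, (X x - m) ∂μ = 0 := by
    rw [integral_sub hiX (integrable_const _)]; simp [hm]
  have hb : ∀ x, |X x - m| ≤ 2 := fun x => by
    rw [abs_le]; constructor <;> linarith [h0 x, h2 x]
  have hup := measureReal_le_sum_le_exp (Y := fun x => X x - m) (by fun_prop) hb hcen hV0 hvar hδ k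
  have hlo := measureReal_le_sum_le_exp (Y := fun x => -(X x - m)) (by fun_prop)
    (fun x => by rw [abs_neg]; exact hb x) (by rw [integral_neg, hcen, neg_zero]) hV0
    (by simpa only [neg_sq] using hvar) hδ k
  refine (measureReal_mono (s₂ := {ω | k * δ ≤ ∑ i, (X (ω i) - m)} ∪
    {ω | k * δ ≤ ∑ i, -(X (ω i) - m)}) fun ω hω => ?_).trans
      ((measureReal_union_le _ _).trans (by linarith))
  have e : ∑ i, (X (ω i) - m) = k * ((k : ℝ)⁻¹ * ∑ i, X (ω i) - m) := by
    rw [Finset.sum_sub_distrib, mul_sub, mul_inv_cancel_left₀ hk'.ne']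
    simp
  rw [Set.mem_union, Set.mem_ofPred_eq, Set.mem_ofPred_eq, Finset.sum_neg_distrib, e, ← mul_neg,
    mul_le_mul_iff_right₀ hk', mul_le_mul_iff_right₀ hk']
  exact le_abs.1 hω

end Concentration

/-! ### Mean and second moment of one coordinate. -/

section Moments

open Filter Topology Set

/-- The uniform law of a phase. -/
noncomputable abbrev phaseLaw : Measure ℝ := (volume : Measure ℝ)[|Set.Icc 0 (2 * Real.pi)]

instance isProbabilityMeasure_phaseLaw : IsProbabilityMeasure phaseLaw :=
  cond_isProbabilityMeasure_of_finite (by simp [Real.pi_pos]) measure_Icc_lt_top.ne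

theorem integral_phaseLaw (f : ℝ → ℝ) :
    ∫ x, f x ∂phaseLaw = (2 * Real.pi)⁻¹ * ∫ x in (0 : ℝ)..(2 * Real.pi), f x := by
  rw [phaseLaw, ProbabilityTheory.cond, integral_smul_measure, Real.volume_Icc, sub_zero,
    intervalIntegral.integral_of_le (by positivity), integral_Icc_eq_integral_Ioc,
    ENNReal.toReal_inv, ENNReal.toReal_ofReal (by positivity), smul_eq_mul]

theorem integral_abs_cos_add_rpow_phaseLaw (q c : ℝ) :
    ∫ x, |Real.cos (x + c)| ^ q ∂phaseLaw = cosMoment q := by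
  rw [integral_phaseLaw, cosMoment,
    intervalIntegral.integral_comp_add_right (fun x => |Real.cos x| ^ q)]
  have hp : Function.Periodic (fun x => |Real.cos x| ^ q) (2 * Real.pi) := fun x => by
    simp only [Real.cos_add_two_pi]
  rw [zero_add, add_comm, hp.intervalIntegral_add_eq c 0, zero_add]

theorem half_le_cosMoment {q : ℝ} (hq0 : 0 ≤ q) (hq2 : q ≤ 2) : 1 / 2 ≤ cosMoment q := by
  have h1 : ∫ x in (0 : ℝ)..(2 * Real.pi), Real.cos x ^ 2 ≤
      ∫ x in (0 : ℝ)..(2 * Real.pi), |Real.cos x| ^ q := by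
    refine intervalIntegral.integral_mono (by positivity)
      (Continuous.intervalIntegrable (by fun_prop) _ _)
      (Continuous.intervalIntegrable
        (Continuous.rpow_const (by fun_prop) fun _ => Or.inr hq0) _ _) fun x => ?_
    exact sq_le_abs_rpow hq2 (Real.abs_cos_le_one _)
  rw [integral_cos_sq] at h1
  simp at h1
  rw [cosMoment, le_inv_mul_iff₀ (by positivity)]
  linarith

/-- Stability, by characteristic functions: independence multiplies the factors `exp (-|t * u j| ^
p)`, and the exponents add up to `|t| ^ p * ∑ j, |u j| ^ p`. -/
theorem map_sum_mul_pi_stableLaw {p : ℝ} (hp0 : 0 < p) (hp2 : p ≤ 2) {m : ℕ} (u : Fin m → ℝ) :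
    (Measure.pi fun _ : Fin m => stableLaw p).map (fun g => ∑ j, g j * u j) =
      (stableLaw p).map (fun x => (∑ j, |u j| ^ p) ^ (1 / p) * x) := by
  have := isProbabilityMeasure_stableLaw hp0 hp2
  have h1 : IsProbabilityMeasure
      ((Measure.pi fun _ : Fin m => stableLaw p).map (fun g => ∑ j, g j * u j)) :=
    Measure.isProbabilityMeasure_map (Measurable.aemeasurable (by fun_prop))
  have h2 : IsProbabilityMeasure
      ((stableLaw p).map (fun x => (∑ j, |u j| ^ p) ^ (1 / p) * x)) :=
    Measure.isProbabilityMeasure_map (Measurable.aemeasurable (by fun_prop))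
  refine Measure.ext_of_charFun (funext fun t => ?_)
  have hn : (0 : ℝ) ≤ ∑ j, |u j| ^ p := Finset.sum_nonneg fun _ _ => by positivity
  have hcf := (isSymmetricStable_stableLaw hp0 hp2).charFun_eq
  rw [charFun_map_mul, hcf, charFun_apply_real, integral_map (Measurable.aemeasurable (by fun_prop)) (by fun_prop)]
  have e : ∀ g : Fin m → ℝ, Complex.exp (t * ((∑ j, g j * u j : ℝ) : ℂ) * Complex.I) =
      ∏ j, Complex.exp (((t * u j : ℝ) : ℂ) * (g j : ℂ) * Complex.I) := fun g => by
    rw [← Complex.exp_sum]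
    congr 1
    push_cast
    rw [Finset.mul_sum, Finset.sum_mul]
    exact Finset.sum_congr rfl fun j _ => by ring
  simp_rw [e]
  rw [integral_fintype_prod_eq_prod
    (fun (j : Fin m) (x : ℝ) => Complex.exp (((t * u j : ℝ) : ℂ) * (x : ℂ) * Complex.I))]
  simp_rw [← charFun_apply_real, hcf]
  rw [← Complex.ofReal_prod, ← Real.exp_sum]
  congr 2
  rw [abs_mul, abs_of_nonneg (Real.rpow_nonneg hn _),
    Real.mul_rpow (Real.rpow_nonneg hn _) (abs_nonneg _), ← Real.rpow_mul hn,
    one_div_mul_cancel hp0.ne', Real.rpow_one, Finset.sum_mul, ← Finset.sum_neg_distrib]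
  refine Finset.sum_congr rfl fun j _ => ?_
  rw [abs_mul, Real.mul_rpow (abs_nonneg _) (abs_nonneg _), mul_comm]

/-- The normalized `q`-th power of the difference of a coordinate at two points. -/
noncomputable def coordinateGap (q s : ℝ) {m : ℕ} (v w : Fin m → ℝ) (x : ℝ × (Fin m → ℝ)) : ℝ :=
  |Real.cos (x.1 + s⁻¹ * ∑ j, x.2 j * (v j + w j))| ^ q *
    |Real.sin (s⁻¹ * ∑ j, x.2 j * (v j - w j))| ^ q / cosMoment q

theorem continuous_coordinateGap {q : ℝ} (hq : 0 ≤ q) (s : ℝ) {m : ℕ} (v w : Fin m → ℝ) :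
    Continuous (coordinateGap q s v w) := by
  unfold coordinateGap
  refine Continuous.div_const (Continuous.mul ?_ ?_) _
  · exact Continuous.rpow_const (by fun_prop) fun _ => Or.inr hq
  · exact Continuous.rpow_const (by fun_prop) fun _ => Or.inr hq

theorem coordinateGap_nonneg {q : ℝ} (hq0 : 0 ≤ q) (hq2 : q ≤ 2) (s : ℝ) {m : ℕ}
    (v w : Fin m → ℝ) (x : ℝ × (Fin m → ℝ)) : 0 ≤ coordinateGap q s v w x := by
  have := half_le_cosMoment hq0 hq2
  unfold coordinateGap
  positivity

theorem coordinateGap_le {q : ℝ} (hq0 : 0 ≤ q) (hq2 : q ≤ 2) (s : ℝ) {m : ℕ}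
    (v w : Fin m → ℝ) (x : ℝ × (Fin m → ℝ)) :
    coordinateGap q s v w x ≤ 2 * |Real.sin (s⁻¹ * ∑ j, x.2 j * (v j - w j))| ^ q := by
  have := half_le_cosMoment hq0 hq2
  unfold coordinateGap
  rw [div_le_iff₀ (by linarith)]
  have h1 : |Real.cos (x.1 + s⁻¹ * ∑ j, x.2 j * (v j + w j))| ^ q ≤ 1 :=
    Real.rpow_le_one (abs_nonneg _) (Real.abs_cos_le_one _) hq0
  have h2 : 0 ≤ |Real.sin (s⁻¹ * ∑ j, x.2 j * (v j - w j))| ^ q := by positivity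
  nlinarith

theorem abs_coordinate_sub_rpow {q : ℝ} (hq1 : 1 ≤ q) (hq2 : q ≤ 2) {s : ℝ} (hs : 0 < s) {m : ℕ}
    (v w : Fin m → ℝ) (φ : ℝ) (g : Fin m → ℝ) :
    |coordinate q s φ g v - coordinate q s φ g w| ^ q = s ^ q * coordinateGap q s v w (φ, g) := by
  have hP := half_le_cosMoment (q := q) (by linarith) hq2
  have hP0 : 0 < cosMoment q := by linarith
  have e : coordinate q s φ g v - coordinate q s φ g w =
      s / cosMoment q ^ (1 / q) * (Real.cos (φ + s⁻¹ * ∑ j, g j * (v j + w j)) *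
        Real.sin (s⁻¹ * ∑ j, g j * (v j - w j))) := by
    unfold coordinate
    -- The factor `2` from sum-to-product cancels the `2` in the normalization, and halving the
    -- arguments turns `2 / s` into `s⁻¹`.
    rw [← mul_sub, Real.sin_sub_sin]
    simp_rw [mul_add, mul_sub, Finset.sum_add_distrib, Finset.sum_sub_distrib]
    rw [show (φ + 2 / s * ∑ j, g j * v j - (φ + 2 / s * ∑ j, g j * w j)) / 2
        = s⁻¹ * (∑ j, g j * v j - ∑ j, g j * w j) by ring,
      show (φ + 2 / s * ∑ j, g j * v j + (φ + 2 / s * ∑ j, g j * w j)) / 2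
        = φ + s⁻¹ * (∑ j, g j * v j + ∑ j, g j * w j) by ring]
    field_simp
  rw [e, abs_mul, abs_mul, abs_of_pos (by positivity), Real.mul_rpow (by positivity) (by positivity),
    Real.mul_rpow (by positivity) (by positivity), Real.div_rpow hs.le (by positivity),
    ← Real.rpow_mul hP0.le, one_div_mul_cancel (by linarith), Real.rpow_one, coordinateGap]
  ring

theorem integral_comp_sum_mul {p : ℝ} (hp0 : 0 < p) (hp2 : p ≤ 2) {s : ℝ} {m : ℕ}
    (u : Fin m → ℝ) {F : ℝ → ℝ} (hF : Continuous F) :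
    ∫ g, F (s⁻¹ * ∑ j, g j * u j) ∂(Measure.pi fun _ : Fin m => stableLaw p) =
      ∫ x, F ((∑ j, |u j| ^ p) ^ (1 / p) / s * x) ∂(stableLaw p) := by
  have h1 := integral_map (μ := Measure.pi fun _ : Fin m => stableLaw p)
    (φ := fun g => ∑ j, g j * u j) (Measurable.aemeasurable (by fun_prop)) (f := fun y => F (s⁻¹ * y)) (by fun_prop)
  have h2 := integral_map (μ := stableLaw p)
    (φ := fun x => (∑ j, |u j| ^ p) ^ (1 / p) * x) (by fun_prop)
    (f := fun y => F (s⁻¹ * y)) (by fun_prop)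
  rw [map_sum_mul_pi_stableLaw hp0 hp2, h2] at h1
  rw [← h1]
  congr 1
  ext x
  congr 1
  ring

theorem integral_coordinateGap {p q : ℝ} (hp0 : 0 < p) (hp2 : p ≤ 2) (hq0 : 0 ≤ q) (hq2 : q ≤ 2)
    (s : ℝ) {m : ℕ} (v w : Fin m → ℝ) :
    ∫ x, coordinateGap q s v w x ∂(phaseLaw.prod (Measure.pi fun _ : Fin m => stableLaw p)) =
      transform p q ((∑ j, |v j - w j| ^ p) ^ (1 / p) / s) := by
  have := isProbabilityMeasure_stableLaw hp0 hp2
  have hP := half_le_cosMoment hq0 hq2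
  have hb : ∀ x, |coordinateGap q s v w x| ≤ 2 := fun x => by
    rw [abs_of_nonneg (coordinateGap_nonneg hq0 hq2 s v w x)]
    refine (coordinateGap_le hq0 hq2 s v w x).trans ?_
    have := Real.rpow_le_one (abs_nonneg _)
      (Real.abs_sin_le_one (s⁻¹ * ∑ j, x.2 j * (v j - w j))) hq0
    linarith
  rw [integral_prod_symm _
    (integrable_of_continuous_bounded (continuous_coordinateGap hq0 s v w) 2 hb)]
  -- For fixed coefficients the sum in the cosine is only a shift of the uniform phase, so its
  -- dependence on the sine factor is harmless.
  have e : ∀ g : Fin m → ℝ, ∫ φ, coordinateGap q s v w (φ, g) ∂phaseLaw =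
      |Real.sin (s⁻¹ * ∑ j, g j * (v j - w j))| ^ q := fun g => by
    simp only [coordinateGap]
    simp_rw [mul_div_assoc]
    rw [integral_mul_const, integral_abs_cos_add_rpow_phaseLaw,
      mul_div_cancel₀ _ (by linarith : cosMoment q ≠ 0)]
  simp_rw [e]
  exact integral_comp_sum_mul hp0 hp2 _
    (F := fun y => |Real.sin y| ^ q) (Continuous.rpow_const (by fun_prop) fun _ => Or.inr hq0)

/-- As `q ≥ 1`, `|sin| ^ q ≤ |sin|`, so the squared gap is at most `4 * sin²`, whose expectation is
explicit. Passing to `sin²` avoids estimating the `2 * q`-th moment and any factor `1 / (2 * q -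
p)`. -/
theorem integral_coordinateGap_sq_le {p q : ℝ} (hp0 : 0 < p) (hp2 : p ≤ 2) (hq1 : 1 ≤ q)
    (hq2 : q ≤ 2) {s : ℝ} (hs : 0 < s) {m : ℕ} (v w : Fin m → ℝ) :
    ∫ x, coordinateGap q s v w x ^ 2 ∂(phaseLaw.prod (Measure.pi fun _ : Fin m => stableLaw p)) ≤
      8 * (min 1 ((∑ j, |v j - w j| ^ p) ^ (1 / p) / s)) ^ p := by
  have := isProbabilityMeasure_stableLaw hp0 hp2
  have hq0 : 0 ≤ q := by linarith
  have hle : ∀ x : ℝ × (Fin m → ℝ), coordinateGap q s v w x ^ 2 ≤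
      4 * Real.sin (s⁻¹ * ∑ j, x.2 j * (v j - w j)) ^ 2 := fun x => by
    have h0 := coordinateGap_nonneg hq0 hq2 s v w x
    have h1 := coordinateGap_le hq0 hq2 s v w x
    have h2 : |Real.sin (s⁻¹ * ∑ j, x.2 j * (v j - w j))| ^ q ≤
        |Real.sin (s⁻¹ * ∑ j, x.2 j * (v j - w j))| ^ (1 : ℝ) :=
      Real.rpow_le_rpow_of_exponent_ge_of_imp (abs_nonneg _) (Real.abs_sin_le_one _) hq1
        fun _ h => absurd h (by linarith)
    rw [Real.rpow_one] at h2
    rw [← sq_abs (Real.sin _)]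
    nlinarith [abs_nonneg (Real.sin (s⁻¹ * ∑ j, x.2 j * (v j - w j)))]
  have hs1 : ∀ y : ℝ, Real.sin y ^ 2 ≤ 1 := Real.sin_sq_le_one
  have hi : Integrable (fun x : ℝ × (Fin m → ℝ) =>
      4 * Real.sin (s⁻¹ * ∑ j, x.2 j * (v j - w j)) ^ 2)
      (phaseLaw.prod (Measure.pi fun _ : Fin m => stableLaw p)) :=
    integrable_of_continuous_bounded (by fun_prop) 4 fun x => by
      rw [abs_of_nonneg (by positivity)]
      linarith [hs1 (s⁻¹ * ∑ j, x.2 j * (v j - w j))]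
  have hi2 := integrable_of_continuous_bounded
    (μ := phaseLaw.prod (Measure.pi fun _ : Fin m => stableLaw p))
    ((continuous_coordinateGap hq0 s v w).pow 2) 4 fun x => by
      rw [Pi.pow_apply, abs_of_nonneg (sq_nonneg _)]
      linarith [hs1 (s⁻¹ * ∑ j, x.2 j * (v j - w j)), hle x]
  refine (integral_mono hi2 hi hle).trans ?_
  rw [integral_prod _ hi]
  simp only [integral_const, probReal_univ, one_smul]
  rw [integral_const_mul, integral_comp_sum_mul hp0 hp2 (s := s) _ (F := fun y => Real.sin y ^ 2)
    (by fun_prop)]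
  have hn : 0 ≤ (∑ j, |v j - w j| ^ p) ^ (1 / p) :=
    Real.rpow_nonneg (Finset.sum_nonneg fun _ _ => by positivity) _
  linarith [integral_sin_sq_le hp0 hp2 (a := (∑ j, |v j - w j| ^ p) ^ (1 / p) / s) (by positivity)]

end Moments

/-! ### Correctness and step count of the program. -/

section RunningTime

/-- The loop body that adds the `j`-th term of the scalar product to the real register `2`; the
integer register `4` runs through the matrix of coefficients. -/
def scalarProductStep : Program :=
  .seq (.load 3 2 4) (.seq (.load 4 0 3) (.seq (.mul 3 3 4) (.seq (.add 2 2 3) (.addInt 4 4 5))))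

/-- The loop body that computes one coordinate of the embedding. -/
def coordinateStep : Program :=
  .seq (.add 2 5 5) (.seq (.loop 3 0 scalarProductStep) (.seq (.mul 2 2 1) (.seq (.load 3 1 2)
    (.seq (.add 2 3 2) (.seq (.sin 2 2) (.seq (.mul 2 0 2) (.store 3 2 2)))))))

/-- The program that computes the embedding. -/
def embeddingProgram : Program :=
  .seq (.setInt 5 1) (.loop 2 1 coordinateStep)

/-- The part of the memory that the computation reads and never changes. -/
structure HoldsInput (m k : ℕ) (α β : ℝ) (x φ G : ℕ → ℝ) (M : Memory) : Prop where
  int_zero : M.int 0 = m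
  int_one : M.int 1 = k
  int_five : M.int 5 = 1
  real_zero : M.real 0 = α
  real_one : M.real 1 = β
  real_five : M.real 5 = 0
  arr_zero : M.arr 0 = x
  arr_one : M.arr 1 = φ
  arr_two : M.arr 2 = G

variable {m k : ℕ} {α β : ℝ} {x φ G : ℕ → ℝ}

theorem scalarProductStep_run {M : Memory} (h : HoldsInput m k α β x φ G M) :
    HoldsInput m k α β x φ G (scalarProductStep.run M).1 ∧
      (scalarProductStep.run M).1.int 4 = M.int 4 + 1 ∧
      (scalarProductStep.run M).1.int 2 = M.int 2 ∧
      (scalarProductStep.run M).1.real 2 = M.real 2 + G (M.int 4) * x (M.int 3) ∧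
      (scalarProductStep.run M).1.arr 3 = M.arr 3 ∧
      (scalarProductStep.run M).2 = 5 := by
  obtain ⟨h1, h2, h3, h4, h5, h6, h7, h8, h9⟩ := h
  refine ⟨⟨?_, ?_, ?_, ?_, ?_, ?_, ?_, ?_, ?_⟩, ?_, ?_, ?_, ?_, ?_⟩ <;>
    simp [scalarProductStep, Program.run, Memory.writeInt, Memory.writeReal, *]

theorem scalarProductLoop_run {M : Memory} (h : HoldsInput m k α β x φ G M) (n : ℕ) :
    HoldsInput m k α β x φ G (runLoop scalarProductStep.run 3 M n).1 ∧
      (runLoop scalarProductStep.run 3 M n).1.int 4 = M.int 4 + n ∧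
      (runLoop scalarProductStep.run 3 M n).1.int 2 = M.int 2 ∧
      (runLoop scalarProductStep.run 3 M n).1.real 2 =
        M.real 2 + ∑ j ∈ Finset.range n, G (M.int 4 + j) * x j ∧
      (runLoop scalarProductStep.run 3 M n).1.arr 3 = M.arr 3 ∧
      (runLoop scalarProductStep.run 3 M n).2 = 1 + 6 * n := by
  induction n with
  | zero => simpa [runLoop] using h
  | succ n ih =>
    obtain ⟨hI, i4, i2, r2, a3, t⟩ := ih
    set B := (runLoop scalarProductStep.run 3 M n).1 with hB
    have hI' : HoldsInput m k α β x φ G (B.writeInt 3 n) := by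
      obtain ⟨h1, h2, h3, h4, h5, h6, h7, h8, h9⟩ := hI
      constructor <;> simpa [Memory.writeInt, Function.update_apply]
    obtain ⟨j1, j2, j3, j4, j5, j6⟩ := scalarProductStep_run hI'
    simp only [runLoop, ← hB]
    refine ⟨j1, ?_, ?_, ?_, ?_, ?_⟩
    · rw [j2]; simp [Memory.writeInt, i4]; ring
    · rw [j3]; simp [Memory.writeInt, i2]
    · rw [j4, Finset.sum_range_succ]
      simp [Memory.writeInt, i4, r2]; ring
    · rw [j5]; simp [Memory.writeInt, a3]
    · rw [j6, t]; ring

/-- Real register `5` always holds zero, so `.add 2 5 5` clears the accumulator. The cost is seven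
single instructions plus `1 + 6 * m` for the inner loop. -/
theorem coordinateStep_run {M : Memory} (h : HoldsInput m k α β x φ G M) :
    HoldsInput m k α β x φ G (coordinateStep.run M).1 ∧
      (coordinateStep.run M).1.int 4 = M.int 4 + m ∧
      (coordinateStep.run M).1.arr 3 = Function.update (M.arr 3) (M.int 2)
        (α * Real.sin (φ (M.int 2) + (∑ j ∈ Finset.range m, G (M.int 4 + j) * x j) * β)) ∧
      (coordinateStep.run M).2 = 8 + 6 * m := by
  have hI' : HoldsInput m k α β x φ G (M.writeReal 2 (M.real 5 + M.real 5)) := by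
    obtain ⟨h1, h2, h3, h4, h5, h6, h7, h8, h9⟩ := h
    constructor <;> simpa [Memory.writeReal, Function.update_apply]
  obtain ⟨⟨h1, h2, h3, h4, h5, h6, h7, h8, h9⟩, j2, j3, j4, j5, j6⟩ := scalarProductLoop_run hI' m
  have hm : (M.writeReal 2 (M.real 5 + M.real 5)).int 0 = m := hI'.int_zero
  have h0 : M.real 5 = 0 := h.real_five
  simp only [coordinateStep, Program.run, hm]
  set B := (runLoop scalarProductStep.run 3 (M.writeReal 2 (M.real 5 + M.real 5)) m) with hB
  refine ⟨⟨?_, ?_, ?_, ?_, ?_, ?_, ?_, ?_, ?_⟩, ?_, ?_, ?_⟩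
  any_goals
    simpa [Memory.writeReal, Memory.writeArr, Function.update_apply]
  · simp [Memory.writeReal] at j3 j4 j5
    simp [Memory.writeReal, Memory.writeArr, h4, h5, h8, j3, j4, j5, h0]
  · rw [j6]; ring

/-- Integer register `4` is never reset between rows: in row-major order it already stands at `i *
m` when row `i` begins, so no integer multiplication is needed. -/
theorem coordinateLoop_run {M : Memory} (h : HoldsInput m k α β x φ G M) (h4 : M.int 4 = 0)
    (n : ℕ) :
    HoldsInput m k α β x φ G (runLoop coordinateStep.run 2 M n).1 ∧
      (runLoop coordinateStep.run 2 M n).1.int 4 = n * m ∧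
      (∀ i < n, (runLoop coordinateStep.run 2 M n).1.arr 3 i =
        α * Real.sin (φ i + (∑ j ∈ Finset.range m, G (i * m + j) * x j) * β)) ∧
      (runLoop coordinateStep.run 2 M n).2 = 1 + (9 + 6 * m) * n := by
  induction n with
  | zero => simpa [runLoop] using ⟨h, h4⟩
  | succ n ih =>
    obtain ⟨hI, i4, a3, t⟩ := ih
    set B := (runLoop coordinateStep.run 2 M n).1 with hB
    have hI' : HoldsInput m k α β x φ G (B.writeInt 2 n) := by
      obtain ⟨h1, h2, h3, h4, h5, h6, h7, h8, h9⟩ := hI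
      constructor <;> simpa [Memory.writeInt, Function.update_apply]
    obtain ⟨j1, j2, j3, j4⟩ := coordinateStep_run hI'
    simp only [runLoop, ← hB]
    have e4 : (B.writeInt 2 n).int 4 = n * m := by
      simpa [Memory.writeInt, Function.update_apply] using i4
    have e2 : (B.writeInt 2 n).int 2 = n := by simp [Memory.writeInt]
    refine ⟨j1, ?_, fun i hi => ?_, ?_⟩
    · rw [j2, e4]; ring
    · rw [j3, e2, e4]
      rcases Nat.lt_succ_iff_lt_or_eq.1 hi with hi | rfl
      · rw [Function.update_of_ne hi.ne]
        exact a3 i hi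
      · rw [Function.update_self]
    · rw [j4, t]; ring

theorem embeddingProgram_run (p q s : ℝ) {m k : ℕ} (hm : 0 < m) (hk : 0 < k) (ω : Draw m k)
    (v : Lp p m) :
    (∀ i : Fin k, (embeddingProgram.run (inputMemory p q s ω v)).1.arr 3 i =
        embedding p q s ω v i) ∧
      (embeddingProgram.run (inputMemory p q s ω v)).2 ≤ 17 * (m * k) := by
  set M := (inputMemory p q s ω v).writeInt 5 1 with hM
  have hI : HoldsInput m k ((k : ℝ) ^ (-(1 / q)) * (s / (2 * cosMoment q ^ (1 / q)))) (2 / s)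
      (toArray v.ofLp) (toArray ω.1) (toArray fun l : Fin (k * m) =>
        ω.2 (finProdFinEquiv.symm l).1 (finProdFinEquiv.symm l).2) M := by
    constructor <;> simp [hM, Memory.writeInt, inputMemory]
  obtain ⟨-, -, h3, ht⟩ := coordinateLoop_run hI
    (by simp [hM, Memory.writeInt, inputMemory]) k
  have hk1 : M.int 1 = k := hI.int_one
  simp only [embeddingProgram, Program.run, ← hM, hk1]
  constructor
  · intro i
    rw [h3 i i.2]
    simp only [embedding, coordinate]
    rw [mul_assoc]
    congr 3
    rw [toArray, dif_pos i.2, mul_comm (2 / s), Finset.sum_range]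
    congr 2
    refine Finset.sum_congr rfl fun j _ => ?_
    have e : (i : ℕ) * m + j = (finProdFinEquiv (i, j) : Fin (k * m)) := by
      simp [finProdFinEquiv]; ring
    rw [e, toArray, dif_pos (Fin.is_lt _), toArray, dif_pos j.2]
    simp only [Fin.eta, Equiv.symm_apply_apply]
  -- The total is `2 + 9 * k + 6 * m * k`, and `m, k ≥ 1` bounds it by `(2 + 9 + 6) * (m * k)`.
  · rw [ht]
    have h1 : 1 ≤ m * k := Nat.mul_pos hm hk
    have h2 : k ≤ m * k := Nat.le_mul_of_pos_left k hm
    nlinarith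

end RunningTime

/-! ### From concentration to the embedding: parameters and union bound. -/

section Embedding

theorem norm_sub_eq {p : ℝ} (hp0 : 0 < p) {m : ℕ} (v w : Lp p m) :
    ‖v - w‖ = (∑ j, |v.ofLp j - w.ofLp j| ^ p) ^ (1 / p) := by
  have h : (ENNReal.ofReal p).toReal = p := ENNReal.toReal_ofReal hp0.le
  rw [PiLp.norm_eq_sum (by rw [h]; exact hp0), h]
  simp [Real.norm_eq_abs]

theorem norm_embedding_sub_rpow {p q s : ℝ} (hq1 : 1 ≤ q) (hq2 : q ≤ 2) (hs : 0 < s) {m k : ℕ}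
    (ω : Draw m k) (v w : Lp p m) :
    ‖embedding p q s ω v - embedding p q s ω w‖ ^ q =
      s ^ q * ((k : ℝ)⁻¹ * ∑ i, coordinateGap q s v.ofLp w.ofLp (ω.1 i, ω.2 i)) := by
  have hq0 : 0 < q := by linarith
  rw [norm_sub_eq hq0, ← Real.rpow_mul (Finset.sum_nonneg fun _ _ => by positivity),
    one_div_mul_cancel hq0.ne', Real.rpow_one, Finset.mul_sum, Finset.mul_sum]
  refine Finset.sum_congr rfl fun i _ => ?_
  simp only [embedding]
  rw [← mul_sub, abs_mul, Real.mul_rpow (abs_nonneg _) (abs_nonneg _),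
    abs_coordinate_sub_rpow hq1 hq2 hs, abs_of_nonneg (by positivity),
    ← Real.rpow_mul (Nat.cast_nonneg k), neg_mul, one_div_mul_cancel hq0.ne', Real.rpow_neg_one]
  ring

/-- Both summands are at most a constant times `s ^ (2 * q)`, which settles that branch of the
minimum, including `2 * q = p`. In the other branch they match the two terms of the maximum. -/
theorem add_le_dimFactor {p q ε s : ℝ} (hq1 : 1 ≤ q) (hqp : q ≤ p) (hp2 : p ≤ 2)
    (hε0 : 0 < ε) (hε1 : ε < 1 / 2) (hs : 1 < s) :
    8192 * s ^ (2 * q - p) + 32 * (ε * s ^ q) ≤ 20000 * dimFactor p q ε s := by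
  have hs0 : 0 < s := by linarith
  have h1 : s ^ (2 * q - p) ≤ s ^ (2 * q) :=
    Real.rpow_le_rpow_of_exponent_le hs.le (by linarith)
  have h2 : s ^ q ≤ s ^ (2 * q) := Real.rpow_le_rpow_of_exponent_le hs.le (by linarith)
  have h3 : 0 < s ^ q := by positivity
  have hA : 8192 * s ^ (2 * q - p) + 32 * (ε * s ^ q) ≤ 20000 * s ^ (2 * q) := by
    nlinarith
  unfold dimFactor
  split_ifs with h
  · exact hA
  · rcases min_choice (s ^ (2 * q)) (max (s ^ (2 * q - p) / (2 * q - p)) (ε * s ^ q)) with e | e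
    · rw [e]; exact hA
    · rw [e]
      have hd : 0 < 2 * q - p := lt_of_le_of_ne (by linarith) fun h' => h (by linarith)
      -- Dividing by `2 * q - p` loses at most a factor `2`, since `2 * q - p ≤ q ≤ 2`.
      have h4 : s ^ (2 * q - p) ≤ 2 * (s ^ (2 * q - p) / (2 * q - p)) := by
        rw [← mul_div_assoc, le_div_iff₀ hd, mul_comm]
        gcongr
        linarith
      have h5 := le_max_left (s ^ (2 * q - p) / (2 * q - p)) (ε * s ^ q)
      have h6 := le_max_right (s ^ (2 * q - p) / (2 * q - p)) (ε * s ^ q)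
      have h7 : 0 < ε * s ^ q := by positivity
      linarith

/-- `V / δ ^ 2 + δ⁻¹` is, up to a constant and the logarithm, the sample size Bernstein requires.
With `8192 = 8 * 32 ^ 2` it involves only powers of `b⁻¹ ≤ s`, with exponents `2 * q - p ≥ 0` and
`q`. -/
theorem div_sq_add_inv_le {p q ε s b V δ : ℝ} (hq1 : 1 ≤ q) (hqp : q ≤ p) (hp2 : p ≤ 2)
    (hε0 : 0 < ε) (hε1 : ε < 1 / 2) (hs : 1 < s) (hb : s⁻¹ ≤ b) (hV : V ≤ 8 * b ^ p)
    (hδ : ε * b ^ q / 32 ≤ δ) :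
    V / δ ^ 2 + δ⁻¹ ≤ 20000 * (dimFactor p q ε s / ε ^ 2) := by
  have hs0 : 0 < s := by linarith
  have hb0 : 0 < b := (inv_pos.2 hs0).trans_le hb
  have hδ0 : 0 < ε * b ^ q / 32 := by positivity
  have hbs : b⁻¹ ≤ s := inv_le_of_inv_le₀ hs0 hb
  have h1 : V / δ ^ 2 ≤ 8192 * s ^ (2 * q - p) / ε ^ 2 := by
    calc V / δ ^ 2 ≤ 8 * b ^ p / (ε * b ^ q / 32) ^ 2 := by gcongr
      _ = 8192 * b⁻¹ ^ (2 * q - p) / ε ^ 2 := by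
        rw [Real.inv_rpow hb0.le, ← Real.rpow_neg hb0.le, neg_sub, Real.rpow_sub hb0,
          mul_comm 2 q, Real.rpow_mul hb0.le, Real.rpow_two]
        field_simp
        norm_num
      _ ≤ 8192 * s ^ (2 * q - p) / ε ^ 2 := by
        gcongr
        linarith
  have h2 : δ⁻¹ ≤ 32 * (ε * s ^ q) / ε ^ 2 := by
    calc δ⁻¹ ≤ (ε * b ^ q / 32)⁻¹ := by gcongr
      _ = 32 * (ε * b⁻¹ ^ q) / ε ^ 2 := by
        rw [Real.inv_rpow hb0.le]
        field_simp
      _ ≤ 32 * (ε * s ^ q) / ε ^ 2 := by gcongr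
  have h3 := add_le_dimFactor hq1 hqp hp2 hε0 hε1 hs
  calc V / δ ^ 2 + δ⁻¹ ≤ (8192 * s ^ (2 * q - p) + 32 * (ε * s ^ q)) / ε ^ 2 := by
        rw [add_div]; exact add_le_add h1 h2
    _ ≤ 20000 * dimFactor p q ε s / ε ^ 2 := by gcongr
    _ = _ := by rw [mul_div_assoc]

theorem isProbabilityMeasure_drawLaw {p : ℝ} (hp0 : 0 < p) (hp2 : p ≤ 2) (m k : ℕ) :
    IsProbabilityMeasure (drawLaw p m k) := by
  have := isProbabilityMeasure_stableLaw hp0 hp2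
  have : IsProbabilityMeasure ((volume : Measure ℝ)[|Set.Icc 0 (2 * Real.pi)]) :=
    isProbabilityMeasure_phaseLaw
  unfold drawLaw
  infer_instance

theorem drawLaw_real_le_abs_mean_sub_le {p q s : ℝ} (hp0 : 0 < p) (hp2 : p ≤ 2) (hq1 : 1 ≤ q)
    (hq2 : q ≤ 2) (hs : 0 < s) {m k : ℕ} (hk : 0 < k) (v w : Lp p m) {δ : ℝ} (hδ : 0 < δ) :
    (drawLaw p m k).real {ω | δ ≤
        |(k : ℝ)⁻¹ * ∑ i, coordinateGap q s v.ofLp w.ofLp (ω.1 i, ω.2 i) -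
          transform p q (‖v - w‖ / s)|} ≤
      2 * Real.exp (-(k * (δ ^ 2 / (4 * (8 * (min 1 (‖v - w‖ / s)) ^ p + δ))))) := by
  have := isProbabilityMeasure_stableLaw hp0 hp2
  have hq0 : 0 ≤ q := by linarith
  have h := measureReal_le_abs_mean_sub_le
    (μ := phaseLaw.prod (Measure.pi fun _ : Fin m => stableLaw p))
    (continuous_coordinateGap hq0 s v.ofLp w.ofLp).measurable
    (coordinateGap_nonneg hq0 hq2 s v.ofLp w.ofLp)
    (fun x => (coordinateGap_le hq0 hq2 s v.ofLp w.ofLp x).trans (by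
      have := Real.rpow_le_one (abs_nonneg _)
        (Real.abs_sin_le_one (s⁻¹ * ∑ j, x.2 j * (v.ofLp j - w.ofLp j))) hq0
      linarith))
    (integral_coordinateGap_sq_le hp0 hp2 hq1 hq2 hs v.ofLp w.ofLp) hδ hk
  rw [integral_coordinateGap hp0 hp2 hq0 hq2, ← norm_sub_eq hp0] at h
  refine le_trans (le_of_eq ?_) h
  -- Regroup all phases and all coefficients into `k` independent pairs, one per coordinate.
  have hmp := measurePreserving_arrowProdEquivProdArrow ℝ (Fin m → ℝ) (Fin k)
    (fun _ => phaseLaw) (fun _ => Measure.pi fun _ : Fin m => stableLaw p)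
  rw [measureReal_def, measureReal_def, drawLaw, ← hmp.measure_preimage_equiv]
  rfl

/-- The admissible deviation of the mean for two points at distance `t`. -/
noncomputable def tolerance (p q ε s t : ℝ) : ℝ :=
  if 1 ≤ t then ε * transform p q (t / s) / 2 else ε * s⁻¹ ^ q / 2

/-- One scale `b` serves both regimes: `min 1 (t / s)` for `t ≥ 1` and `s⁻¹` for `t < 1`. The `32`
is the `16` of the lower bound on `H` times the `2` in the tolerance. -/
theorem tolerance_bounds {p q ε s t : ℝ} (hq1 : 1 ≤ q) (hqp : q ≤ p) (hp2 : p ≤ 2)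
    (hε0 : 0 < ε) (hs : 1 < s) (ht : 0 ≤ t) :
    ∃ b, s⁻¹ ≤ b ∧ 8 * (min 1 (t / s)) ^ p ≤ 8 * b ^ p ∧ ε * b ^ q / 32 ≤ tolerance p q ε s t := by
  have hs0 : 0 < s := by linarith
  have hp0 : 0 < p := by linarith
  have hts : 0 ≤ t / s := by positivity
  have hs1 : s⁻¹ ≤ 1 := inv_le_one_of_one_le₀ hs.le
  unfold tolerance
  split_ifs with h
  · have h1 : s⁻¹ ≤ t / s := by rw [← one_div]; gcongr
    refine ⟨min 1 (t / s), le_min hs1 h1, le_rfl, ?_⟩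
    have := min_rpow_le_transform hp0 hp2 (by linarith : 0 ≤ q) (by linarith)
      ((inv_pos.2 hs0).trans_le h1)
    nlinarith
  · refine ⟨s⁻¹, le_rfl, ?_, ?_⟩
    · gcongr
      refine (min_le_right _ _).trans ?_
      rw [← one_div]
      push Not at h
      gcongr
    · have : 0 < ε * s⁻¹ ^ q := by positivity
      linarith

theorem tolerance_pos {p q ε s t : ℝ} (hq1 : 1 ≤ q) (hqp : q ≤ p) (hp2 : p ≤ 2)
    (hε0 : 0 < ε) (hs : 1 < s) (ht : 0 ≤ t) : 0 < tolerance p q ε s t := by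
  obtain ⟨b, hb, -, h⟩ := tolerance_bounds hq1 hqp hp2 hε0 hs ht
  have hb0 : 0 < b := (inv_pos.2 (by linarith)).trans_le hb
  exact lt_of_lt_of_le (by positivity) h

theorem bounds_of_abs_sub_lt_tolerance {p q ε s t X : ℝ} (hq1 : 1 ≤ q) (hqp : q ≤ p) (hp2 : p ≤ 2)
    (hε0 : 0 < ε) (hε1 : ε < 1 / 2) (hs : 1 < s) (ht : 0 ≤ t)
    (hX : |X - transform p q (t / s)| < tolerance p q ε s t) :
    s ^ q * X < s ^ q ∧
      (1 ≤ t → (1 - ε) * (s ^ q * transform p q (t / s)) ≤ s ^ q * X ∧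
        s ^ q * X ≤ (1 + ε) * (s ^ q * transform p q (t / s))) ∧
      (t < 1 → s ^ q * X ≤ s ^ q * transform p q (1 / s) + ε) := by
  have hs0 : 0 < s := by linarith
  have hp0 : 0 < p := by linarith
  have hsq : 0 < s ^ q := by positivity
  have hH := transform_le hp0 hp2 hq1 (t / s)
  have hH0 := transform_nonneg p q (t / s)
  rw [abs_lt] at hX
  obtain ⟨hX1, hX2⟩ := hX
  unfold tolerance at hX1 hX2
  split_ifs at hX1 hX2 with h
  · have hεH : 0 ≤ ε * transform p q (t / s) := by positivity
    -- Threshold: `X < (1 + ε / 2) * H ≤ 5 / 4 * 17 / 24 < 1`.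
    refine ⟨mul_lt_of_lt_one_right hsq (by nlinarith), fun _ => ⟨?_, ?_⟩,
      fun h' => absurd h (not_le.2 h')⟩
    · rw [mul_left_comm]
      gcongr
      linarith
    · rw [mul_left_comm]
      gcongr
      linarith
  · have hi : s⁻¹ ^ q ≤ 1 := Real.rpow_le_one (by positivity) (inv_le_one_of_one_le₀ hs.le)
      (by linarith)
    have hi0 : 0 < s⁻¹ ^ q := by positivity
    -- Threshold: `X < 17 / 24 + 1 / 4 < 1`.
    refine ⟨mul_lt_of_lt_one_right hsq (by nlinarith), fun h' => absurd h' h, fun h' => ?_⟩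
    have hm : transform p q (t / s) ≤ transform p q (1 / s) :=
      transform_mono hp0 hp2 (by linarith) (by linarith) (by positivity) (by gcongr)
    have hc : s ^ q * s⁻¹ ^ q = 1 := by
      rw [← Real.mul_rpow hs0.le (by positivity), mul_inv_cancel₀ hs0.ne', Real.one_rpow]
    calc s ^ q * X ≤ s ^ q * (transform p q (1 / s) + ε * s⁻¹ ^ q / 2) := by
          gcongr; linarith
      _ = s ^ q * transform p q (1 / s) + ε / 2 * (s ^ q * s⁻¹ ^ q) := by ring
      _ ≤ s ^ q * transform p q (1 / s) + ε := by rw [hc]; linarith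

theorem drawLaw_tolerance_le {p q ε s : ℝ} (hq1 : 1 ≤ q) (hqp : q ≤ p) (hp2 : p ≤ 2)
    (hε0 : 0 < ε) (hε1 : ε < 1 / 2) (hs : 1 < s) {m k n : ℕ} (hn : 2 ≤ n)
    (hk : 320000 * (Real.log n / ε ^ 2 * dimFactor p q ε s) ≤ k) (v w : Lp p m) :
    drawLaw p m k {ω | tolerance p q ε s ‖v - w‖ ≤
        |(k : ℝ)⁻¹ * ∑ i, coordinateGap q s v.ofLp w.ofLp (ω.1 i, ω.2 i) -
          transform p q (‖v - w‖ / s)|} ≤ ENNReal.ofReal (1 / (2 * (n : ℝ) ^ 2)) := by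
  have hp0 : 0 < p := by linarith
  have hs0 : 0 < s := by linarith
  have := isProbabilityMeasure_drawLaw hp0 hp2 m k
  have hn' : (2 : ℝ) ≤ n := by exact_mod_cast hn
  have hlog : 0 < Real.log n := Real.log_pos (by linarith)
  -- Without an instance of `Fact (1 ≤ ENNReal.ofReal p)` this is a bare `Norm`, so nonnegativity is
  -- read off the formula.
  have ht : 0 ≤ ‖v - w‖ := by
    rw [norm_sub_eq hp0]
    exact Real.rpow_nonneg (Finset.sum_nonneg fun _ _ => by positivity) _
  set V := 8 * (min 1 (‖v - w‖ / s)) ^ p with hVdef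
  set δ := tolerance p q ε s ‖v - w‖ with hδdef
  have hV0 : 0 ≤ V := by
    have : 0 ≤ min 1 (‖v - w‖ / s) := le_min zero_le_one (by positivity)
    positivity
  have hδ : 0 < δ := tolerance_pos hq1 hqp hp2 hε0 hs ht
  obtain ⟨b, hb1, hb2, hb3⟩ := tolerance_bounds hq1 hqp hp2 hε0 hs ht
  have hD := div_sq_add_inv_le hq1 hqp hp2 hε0 hε1 hs hb1 hb2 hb3
  have hk2 : 16 * Real.log n * (V / δ ^ 2 + δ⁻¹) ≤ k := by
    calc 16 * Real.log n * (V / δ ^ 2 + δ⁻¹)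
        ≤ 16 * Real.log n * (20000 * (dimFactor p q ε s / ε ^ 2)) := by gcongr
      _ = 320000 * (Real.log n / ε ^ 2 * dimFactor p q ε s) := by ring
      _ ≤ k := hk
  have hk0 : 0 < k := by
    have : (0 : ℝ) < k := lt_of_lt_of_le (by positivity) hk2
    exact_mod_cast this
  -- The factor `16 = 4 * 4` absorbs the `4` in Bernstein's exponent and leaves `4 * log n`, so a
  -- pair fails with probability at most `2 / n ^ 4`; this is at most `1 / (2 * n ^ 2)` because `n ≥
  -- 2`.
  have hexp : 4 * Real.log n ≤ k * (δ ^ 2 / (4 * (V + δ))) := by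
    calc 4 * Real.log n = 16 * Real.log n * (V / δ ^ 2 + δ⁻¹) * (δ ^ 2 / (4 * (V + δ))) := by
          field_simp
          norm_num
      _ ≤ k * (δ ^ 2 / (4 * (V + δ))) := by gcongr
  rw [← ofReal_measureReal]
  refine ENNReal.ofReal_le_ofReal
    ((drawLaw_real_le_abs_mean_sub_le hp0 hp2 hq1 (by linarith) hs0 hk0 v w hδ).trans ?_)
  calc 2 * Real.exp (-(k * (δ ^ 2 / (4 * (V + δ))))) ≤ 2 * Real.exp (-(4 * Real.log n)) := by
        gcongr
    _ = 2 / (n : ℝ) ^ 4 := by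
        rw [Real.exp_neg, show (4 : ℝ) * Real.log n = ((4 : ℕ) : ℝ) * Real.log n by norm_num,
          Real.exp_nat_mul, Real.exp_log (by linarith)]
        rfl
    _ ≤ 1 / (2 * (n : ℝ) ^ 2) := by
        rw [div_le_div_iff₀ (by positivity) (by positivity)]
        nlinarith [mul_nonneg (sq_nonneg (n : ℝ)) (by nlinarith : (0 : ℝ) ≤ (n : ℝ) ^ 2 - 4)]

/-- `G` and the bad sets together cover the whole space, so subadditivity suffices and no
measurability is needed. -/
theorem half_le_measure_of_pairs {Ω ι : Type*} [MeasurableSpace Ω] {μ : Measure Ω}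
    [IsProbabilityMeasure μ] (S : Finset ι) (hS : S.card ≠ 0) (bad : ι → ι → Set Ω)
    (h : ∀ v ∈ S, ∀ w ∈ S, μ (bad v w) ≤ ENNReal.ofReal (1 / (2 * (S.card : ℝ) ^ 2))) {G : Set Ω}
    (hG : ∀ ω, (∀ v ∈ S, ∀ w ∈ S, ω ∉ bad v w) → ω ∈ G) : 1 / 2 ≤ μ G := by
  have hS' : (0 : ℝ) < S.card := by positivity
  have h1 : μ (⋃ x ∈ S ×ˢ S, bad x.1 x.2) ≤ 1 / 2 := by
    calc μ (⋃ x ∈ S ×ˢ S, bad x.1 x.2) ≤ ∑ x ∈ S ×ˢ S, μ (bad x.1 x.2) :=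
          measure_biUnion_finset_le _ _
      _ ≤ ∑ x ∈ S ×ˢ S, ENNReal.ofReal (1 / (2 * (S.card : ℝ) ^ 2)) :=
          Finset.sum_le_sum fun x hx =>
            h _ (Finset.mem_product.1 hx).1 _ (Finset.mem_product.1 hx).2
      _ = ENNReal.ofReal (1 / 2) := by
          rw [Finset.sum_const, ← ENNReal.ofReal_nsmul, Finset.card_product, nsmul_eq_mul]
          congr 1
          push_cast
          field_simp
      _ = 1 / 2 := by rw [ENNReal.ofReal_div_of_pos two_pos]; simp
  have h2 : (1 : ENNReal) ≤ μ G + 1 / 2 := by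
    calc (1 : ENNReal) = μ Set.univ := measure_univ.symm
      _ ≤ μ (G ∪ ⋃ x ∈ S ×ˢ S, bad x.1 x.2) := by
          refine measure_mono fun ω _ => ?_
          by_cases hω : ω ∈ G
          · exact Or.inl hω
          · right
            by_contra h'
            refine hω (hG ω fun v hv w hw hb => h' ?_)
            simp only [Set.mem_iUnion]
            exact ⟨(v, w), Finset.mem_product.2 ⟨hv, hw⟩, hb⟩
      _ ≤ μ G + μ (⋃ x ∈ S ×ˢ S, bad x.1 x.2) := measure_union_le _ _
      _ ≤ μ G + 1 / 2 := by gcongr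
  refine (ENNReal.add_le_add_iff_right (a := 1 / 2) (by simp)).1 ?_
  rwa [ENNReal.add_halves]

theorem half_le_drawLaw {p q ε s : ℝ} (hq1 : 1 ≤ q) (hqp : q ≤ p) (hp2 : p ≤ 2)
    (hε0 : 0 < ε) (hε1 : ε < 1 / 2) (hs : 1 < s) {m k : ℕ} (S : Finset (Lp p m))
    (hk : 320000 * (Real.log S.card / ε ^ 2 * dimFactor p q ε s) ≤ k) :
    1 / 2 ≤ drawLaw p m k
      {ω | ∀ v ∈ S, ∀ w ∈ S,
        ‖embedding p q s ω v - embedding p q s ω w‖ ^ q < s ^ q ∧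
        (1 ≤ ‖v - w‖ →
          (1 - ε) * (s ^ q * transform p q (‖v - w‖ / s)) ≤
            ‖embedding p q s ω v - embedding p q s ω w‖ ^ q ∧
          ‖embedding p q s ω v - embedding p q s ω w‖ ^ q ≤
            (1 + ε) * (s ^ q * transform p q (‖v - w‖ / s))) ∧
        (‖v - w‖ < 1 →
          ‖embedding p q s ω v - embedding p q s ω w‖ ^ q ≤
            s ^ q * transform p q (1 / s) + ε)} := by
  have hp0 : 0 < p := by linarith
  have hq0 : 0 < q := by linarith
  have hs0 : 0 < s := by linarith
  have := isProbabilityMeasure_drawLaw hp0 hp2 m k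
  -- For at most one point the logarithm is `0` and `k = 0` is allowed; then all differences vanish
  -- and the bounds hold for every draw.
  rcases le_or_gt S.card 1 with hS | hS
  · have hall : ∀ ω : Draw m k, ∀ v ∈ S, ∀ w ∈ S,
        ‖embedding p q s ω v - embedding p q s ω w‖ ^ q = 0 ∧ ‖v - w‖ = 0 := by
      intro ω v hv w hw
      obtain rfl := Finset.card_le_one.1 hS v hv w hw
      rw [norm_sub_eq hq0, norm_sub_eq hp0]
      simp [Real.zero_rpow, hp0.ne', hq0.ne']
    refine le_trans ?_ (measure_mono (s := Set.univ) fun ω _ v hv w hw => ?_)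
    · rw [measure_univ]; simp
    · obtain ⟨h1, h2⟩ := hall ω v hv w hw
      rw [h1, h2]
      have := transform_nonneg p q (1 / s)
      exact ⟨by positivity, fun h => absurd h (by norm_num), fun _ => by positivity⟩
  · refine half_le_measure_of_pairs S (by omega) _
      (fun v _ w _ => drawLaw_tolerance_le hq1 hqp hp2 hε0 hε1 hs hS hk v w)
      fun ω hω v hv w hw => ?_
    rw [norm_embedding_sub_rpow hq1 (hqp.trans hp2) hs0]
    refine bounds_of_abs_sub_lt_tolerance hq1 hqp hp2 hε0 hε1 hs ?_ (not_le.1 (hω v hv w hw))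
    rw [norm_sub_eq hp0]
    exact Real.rpow_nonneg (Finset.sum_nonneg fun _ _ => by positivity) _

end Embedding
end SineEmbedding


theorem theorem3p1 :
    (∃ C : ℝ, 0 < C ∧
      ∀ p q ε s : ℝ, 1 ≤ q → q ≤ p → p ≤ 2 → 0 < ε → ε < 1 / 2 → 1 < s →
      ∀ (m k : ℕ) (S : Finset (SineEmbedding.Lp p m)),
        C * (Real.log (S.card : ℝ) / ε ^ 2 * SineEmbedding.dimFactor p q ε s) ≤ (k : ℝ) →
        1 / 2 ≤ SineEmbedding.drawLaw p m k
          {ω | ∀ v ∈ S, ∀ w ∈ S,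
            ‖SineEmbedding.embedding p q s ω v - SineEmbedding.embedding p q s ω w‖ ^ q < s ^ q ∧
            (1 ≤ ‖v - w‖ →
              (1 - ε) * (s ^ q * SineEmbedding.transform p q (‖v - w‖ / s)) ≤
                ‖SineEmbedding.embedding p q s ω v - SineEmbedding.embedding p q s ω w‖ ^ q ∧
              ‖SineEmbedding.embedding p q s ω v - SineEmbedding.embedding p q s ω w‖ ^ q ≤
                (1 + ε) * (s ^ q * SineEmbedding.transform p q (‖v - w‖ / s))) ∧
            (‖v - w‖ < 1 →
              ‖SineEmbedding.embedding p q s ω v - SineEmbedding.embedding p q s ω w‖ ^ q ≤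
                s ^ q * SineEmbedding.transform p q (1 / s) + ε)}) ∧
    (∃ (prog : SineEmbedding.Program) (C : ℕ),
      ∀ p q s : ℝ, 1 ≤ q → q ≤ p → p ≤ 2 → 1 < s →
      ∀ m k : ℕ, 0 < m → 0 < k →
      ∀ (ω : SineEmbedding.Draw m k) (v : SineEmbedding.Lp p m),
        (∀ i : Fin k, (prog.run (SineEmbedding.inputMemory p q s ω v)).1.arr 3 i =
          SineEmbedding.embedding p q s ω v i) ∧
        (prog.run (SineEmbedding.inputMemory p q s ω v)).2 ≤ C * (m * k)) := by
  exact ⟨⟨320000, by norm_num, fun p q ε s hq1 hqp hp2 hε0 hε1 hs m k S hk =>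
      SineEmbedding.half_le_drawLaw hq1 hqp hp2 hε0 hε1 hs S hk⟩,
    ⟨SineEmbedding.embeddingProgram, 17, fun p q s _ _ _ _ m k hm hk ω v =>
      SineEmbedding.embeddingProgram_run p q s hm hk ω v⟩⟩
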